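/- Let $\mathbb H=\{z\in\mathbb C:\operatorname{Im} z>0\}$ and let $\mu$ be a probability measure on $\mathbb R$ with $\mu([-R,R])=1$ for some $R$. Let $M_t(z)$, $t\ge 0$, $z\in\mathbb H$, be a classical solution (jointly continuous in $(t,z)$, holomorphic in $z$ and differentiable in $t$) of the complex Burgers equation $$\frac{\partial M_t(z)}{\partial t}=-2M_t(z)\,\frac{\partial M_t(z)}{\partial z},\qquad M_0(z)=\int_{\mathbb R}\frac{2\,\mu(du)}{z-u}.$$ For $t\ge 0$ let $D_t$ be the set of those $z\in\mathbb H$ for which the Loewner equation $$\dot g_s(z)=M_s(g_s(z)),\qquad g_0(z)=z,$$ has a solution with values in $\mathbb H$ on the whole interval $0\le s\le t$, and let $K_t=\mathbb H\setminus D_t$. Then $K_t$ is bounded for every $t\ge 0$, and there exists $T>0$ such that for every $t>T$ the set $\partial K_t\cap\mathbb H$ is an analytic curve, i.e. the image of an open interval under a real-analytic map into $\mathbb C$ whose derivative vanishes nowhere and which is a homeomorphism onto its image. -/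

import Mathlib

open MeasureTheory Set

noncomputable section

/-- `M` (first argument: time, second argument: point) is a classical solution on the upper
half-plane, for all times `t ≥ 0`, of the complex Burgers equation
`∂M/∂t = -2 M ∂M/∂z` with initial value `M 0 z = ∫ 2 / (z - u) dμ(u)`.
Only the values `M t z` with `0 ≤ t` and `0 < z.im` matter. -/
structure IsBurgersSolution (μ : Measure ℝ) (M : ℝ → ℂ → ℂ) : Prop where
  continuousOn : ContinuousOn (fun p : ℝ × ℂ => M p.1 p.2)
    (Ici (0 : ℝ) ×ˢ {z : ℂ | 0 < z.im})
  differentiableOn : ∀ t : ℝ, 0 ≤ t → DifferentiableOn ℂ (M t) {z : ℂ | 0 < z.im}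
  burgers : ∀ t : ℝ, 0 ≤ t → ∀ z : ℂ, 0 < z.im →
    HasDerivWithinAt (fun s => M s z) (-2 * M t z * deriv (M t) z) (Ici (0 : ℝ)) t
  initial : ∀ z : ℂ, 0 < z.im → M 0 z = ∫ u : ℝ, 2 / (z - (u : ℂ)) ∂μ

/-- `w` solves the Loewner equation `w'(s) = M s (w s)`, `w 0 = z`, on the time interval `[0, t]`
and stays in the upper half-plane on the whole (closed) interval. -/
def IsLoewnerTrajectory (M : ℝ → ℂ → ℂ) (t : ℝ) (z : ℂ) (w : ℝ → ℂ) : Prop :=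
  w 0 = z ∧ ∀ s ∈ Icc (0 : ℝ) t,
    0 < (w s).im ∧ HasDerivWithinAt w (M s (w s)) (Icc (0 : ℝ) t) s

/-- The domain `D_t` of the Loewner map `g_t`: the points of the upper half-plane from which the
solution of the Loewner equation exists, inside the upper half-plane, up to and including
time `t` (so the lifetime of the solution is larger than `t`). -/
def loewnerDomain (M : ℝ → ℂ → ℂ) (t : ℝ) : Set ℂ :=
  {z : ℂ | 0 < z.im ∧ ∃ w : ℝ → ℂ, IsLoewnerTrajectory M t z w}

/-- The hull `K_t`, the complement of `D_t` in the upper half-plane. -/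
def loewnerHull (M : ℝ → ℂ → ℂ) (t : ℝ) : Set ℂ :=
  {z : ℂ | 0 < z.im} \ loewnerDomain M t

/-- `C` is a (simple, regular, open) analytic curve in the plane: the image of a nonempty open
interval under a real-analytic map with nowhere vanishing derivative which is a homeomorphism
onto its image. -/
def IsAnalyticCurve (C : Set ℂ) : Prop :=
  ∃ (a b : ℝ) (γ : ℝ → ℂ), a < b ∧ AnalyticOnNhd ℝ γ (Ioo a b) ∧
    (∀ s ∈ Ioo a b, deriv γ s ≠ 0) ∧
    Topology.IsEmbedding (fun s : Ioo a b => γ s) ∧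
    γ '' Ioo a b = C

end

/-!
Write `G` for the function `cauchyTransform μ`, which is the initial value `M 0`, and `F` for its
primitive `logPotential μ`.

*Burgers equation.* Along a straight characteristic `s ↦ ζ + 2 s G ζ` the solution keeps the value
`G ζ` as long as the characteristic stays in the upper half-plane, that is for `ζ` in the set
`charDomain μ s`, given by `4 s ∫ |ζ - u|⁻² dμ(u) < 1`
(`IsBurgersSolution.apply_charMap`). The map `charMap μ s : ζ ↦ ζ + 2 s G ζ` is a bijection from
this set onto the upper half-plane (`charMap_injOn`, `exists_charMap_eq`), so the solution is
determined by `μ`, and it has the bounds needed to solve the Loewner equation backwards.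

*Loewner equation.* If `y` is a trajectory and `ζ s` is the foot of the characteristic through
`y s` at time `s`, then `F (ζ s) + s G (ζ s) ^ 2` is constant
(`IsLoewnerTrajectory.potentialMap_eq`). As `F` is injective on the upper half-plane, the domain
of the Loewner map at time `t` is the preimage under `F` of the image of `charDomain μ t` under
`E = F + t G ^ 2`, which is `potentialMap μ t` (`IsBurgersSolution.mem_loewnerDomain_iff`).

*Geometry of the hull.* On the real line off the support of `μ` the imaginary parts of `F` and `E`
are `0` or `2 π`, whereas `Im F` lies strictly between these values in the upper half-plane. Also
`|Re E - Re F| ≤ 1` on the closure of `charDomain μ t`, so that points matched by `F z = E ζ` have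
comparable moduli. Hence the domain is relatively clopen in `{0 < im, C < ‖z‖}` for large `C`, and
the hull is bounded. For `t > 9 R ^ 2` the closure of `charDomain μ t` stays away from `[-R, R]`,
and the same compactness argument identifies the boundary of the hull in the upper half-plane with
`F⁻¹ (E (charCurve μ t))` (`IsBurgersSolution.frontier_loewnerHull`). The curve `charCurve μ t` is
the part in the upper half-plane of the preimage of the real line under `charMap μ t`, and it is
parametrized by its image `x`, which runs through an open interval (`exists_hitSet_eq_Ioo`). In this
parameter `E` has derivative `G`, whose imaginary part is negative. Therefore `Im E` is strictly
monotone along the curve, which shows that `E` takes values in `F` of the upper half-plane, that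
`x ↦ F⁻¹ (E ζ)` has no critical point, and that it is an embedding.
-/

noncomputable section

open Filter Topology ComplexConjugate

/-! ### Integrals of kernels against a compactly supported measure -/

/-- The points of the plane which lie in the upper half-plane or outside the closed disc of
radius `R`: an open set which avoids `[-R, R]`. -/
def exteriorRegion (R : ℝ) : Set ℂ := {z | 0 < z.im ∨ R < ‖z‖}

lemma sub_ofReal_im (z : ℂ) (u : ℝ) : (z - (u : ℂ)).im = z.im := by simp

lemma im_le_norm_sub_ofReal (z : ℂ) (u : ℝ) : z.im ≤ ‖z - (u : ℂ)‖ := by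
  have := Complex.abs_im_le_norm (z - (u : ℂ))
  rw [sub_ofReal_im] at this
  exact (le_abs_self _).trans this

lemma norm_sub_le_norm_sub_ofReal {R : ℝ} (z : ℂ) {u : ℝ} (hu : |u| ≤ R) :
    ‖z‖ - R ≤ ‖z - (u : ℂ)‖ := by
  have := norm_sub_norm_le z (u : ℂ)
  rw [Complex.norm_real, Real.norm_eq_abs] at this
  linarith

lemma norm_sub_ofReal_le {R : ℝ} (z : ℂ) {u : ℝ} (hu : |u| ≤ R) :
    ‖z - (u : ℂ)‖ ≤ ‖z‖ + R := by
  have := norm_sub_le z (u : ℂ)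
  rw [Complex.norm_real, Real.norm_eq_abs] at this
  linarith

lemma exists_eventually_le_norm_sub {R : ℝ} {z₀ : ℂ} (h : z₀ ∈ exteriorRegion R) :
    ∃ δ > 0, ∀ᶠ z in 𝓝 z₀, ∀ u : ℝ, |u| ≤ R → δ ≤ ‖z - (u : ℂ)‖ := by
  rcases h with h | h
  · refine ⟨z₀.im / 2, by positivity, ?_⟩
    filter_upwards [Complex.continuous_im.continuousAt.eventually_const_lt
      (show z₀.im / 2 < z₀.im by linarith)] with z hz u _
    exact hz.le.trans (im_le_norm_sub_ofReal z u)
  · refine ⟨(‖z₀‖ - R) / 2, by linarith, ?_⟩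
    filter_upwards [continuous_norm.continuousAt.eventually_const_lt
      (show (‖z₀‖ + R) / 2 < ‖z₀‖ by linarith)] with z hz u hu
    have := norm_sub_le_norm_sub_ofReal z hu
    linarith

lemma sub_ne_zero_of_mem_exteriorRegion {R : ℝ} {z : ℂ} (h : z ∈ exteriorRegion R) {u : ℝ}
    (hu : |u| ≤ R) : z - (u : ℂ) ≠ 0 := by
  obtain ⟨δ, hδ, h⟩ := exists_eventually_le_norm_sub h
  exact norm_pos_iff.1 (hδ.trans_le (h.self_of_nhds u hu))

section Kernel

variable {E : Type*} [NormedAddCommGroup E] {μ : Measure ℝ} [IsProbabilityMeasure μ] {R : ℝ}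
  {φ : ℂ → E}

lemma integrable_kernel (hμ : ∀ᵐ u ∂μ, |u| ≤ R) (hφ : StronglyMeasurable φ)
    (hb : ∀ δ > 0, ∀ C, ∃ B, ∀ x, δ ≤ ‖x‖ → ‖x‖ ≤ C → ‖φ x‖ ≤ B) {z : ℂ}
    (hz : z ∈ exteriorRegion R) : Integrable (fun u : ℝ => φ (z - u)) μ := by
  obtain ⟨δ, hδ, h⟩ := exists_eventually_le_norm_sub hz
  obtain ⟨B, hB⟩ := hb δ hδ (‖z‖ + R)
  refine Integrable.mono' (integrable_const B)
    (hφ.comp_measurable (by fun_prop)).aestronglyMeasurable ?_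
  filter_upwards [hμ] with u hu
  exact hB _ (h.self_of_nhds u hu) (norm_sub_ofReal_le z hu)

lemma continuousWithinAt_integral_kernel [NormedSpace ℝ E] (hμ : ∀ᵐ u ∂μ, |u| ≤ R)
    (hφ : StronglyMeasurable φ)
    (hb : ∀ δ > 0, ∀ C, ∃ B, ∀ x, δ ≤ ‖x‖ → ‖x‖ ≤ C → ‖φ x‖ ≤ B) {S : Set ℂ}
    (hS : ∀ z ∈ S, ∀ u : ℝ, z - u ∈ S)
    (hc : ∀ z ∈ S, z ≠ 0 → ContinuousWithinAt φ S z) {z : ℂ}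
    (hz : z ∈ exteriorRegion R) (hzS : z ∈ S) :
    ContinuousWithinAt (fun z => ∫ u : ℝ, φ (z - u) ∂μ) S z := by
  obtain ⟨δ, hδ, h⟩ := exists_eventually_le_norm_sub hz
  obtain ⟨B, hB⟩ := hb δ hδ (‖z‖ + 1 + R)
  refine continuousWithinAt_of_dominated (bound := fun _ => B)
    (Eventually.of_forall fun z => (hφ.comp_measurable (by fun_prop)).aestronglyMeasurable)
    ?_ (integrable_const B) ?_
  · filter_upwards [nhdsWithin_le_nhds h, nhdsWithin_le_nhds
      (continuous_norm.continuousAt.eventually_lt_const (show ‖z‖ < ‖z‖ + 1 by linarith))]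
      with y hy hy'
    filter_upwards [hμ] with u hu
    exact hB _ (hy u hu) (by linarith [norm_sub_ofReal_le y hu])
  · filter_upwards [hμ] with u hu
    exact ContinuousWithinAt.comp (f := fun y : ℂ => y - u)
      (hc _ (hS z hzS u) (sub_ne_zero_of_mem_exteriorRegion hz hu))
      (by fun_prop) (fun y hy => hS y hy u)

lemma integral_pos_of_ae_pos {f : ℝ → ℝ} (hf : Integrable f μ) (h : ∀ᵐ u ∂μ, 0 < f u) :
    0 < ∫ u, f u ∂μ := by
  rw [integral_pos_iff_support_of_nonneg_ae (h.mono fun u hu => hu.le) hf]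
  have h1 : μ (Function.support f)ᶜ = 0 := by
    refine measure_mono_null (fun u hu => ?_) h
    simp only [mem_compl_iff, Function.mem_support, not_not] at hu
    simp [hu]
  rw [pos_iff_ne_zero]
  intro h0
  have : μ univ = 0 := by
    rw [← union_compl_self (Function.support f)]
    exact measure_union_null h0 h1
  simp at this

end Kernel

/-! ### The Cauchy transform, the logarithmic potential and the maps built from them -/

/-- Twice the Cauchy transform of `μ`. -/
def cauchyTransform (μ : Measure ℝ) (z : ℂ) : ℂ := ∫ u : ℝ, 2 / (z - (u : ℂ)) ∂μ

/-- The integral of `|z - u|⁻²` against `μ`. -/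
def invSqDist (μ : Measure ℝ) (z : ℂ) : ℝ := ∫ u : ℝ, 1 / ‖z - (u : ℂ)‖ ^ 2 ∂μ

/-- Twice the complex logarithmic potential of `μ`, a primitive of `cauchyTransform μ` in the upper
half-plane. The principal logarithm is continuous up to the real line from above, so this formula
also gives the boundary values from above off the support of `μ`. -/
def logPotential (μ : Measure ℝ) (z : ℂ) : ℂ := ∫ u : ℝ, 2 * Complex.log (z - (u : ℂ)) ∂μ

/-- The position at time `t` of the characteristic of the Burgers equation which starts
at `z`. -/
def charMap (μ : Measure ℝ) (t : ℝ) (z : ℂ) : ℂ := z + 2 * t * cauchyTransform μ z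

/-- The function `F + t G ^ 2`, with `G` the Cauchy transform and `F` the logarithmic potential: its
value at the foot of the characteristic through a Loewner trajectory does not change with `t`. -/
def potentialMap (μ : Measure ℝ) (t : ℝ) (z : ℂ) : ℂ :=
  logPotential μ z + t * cauchyTransform μ z ^ 2

/-- The points of the upper half-plane whose characteristic is still in the upper half-plane at
time `t`. -/
def charDomain (μ : Measure ℝ) (t : ℝ) : Set ℂ := {z | 0 < z.im ∧ 4 * t * invSqDist μ z < 1}

/-- The points of the upper half-plane whose characteristic hits the real line at time `t`. -/
def charCurve (μ : Measure ℝ) (t : ℝ) : Set ℂ := {z | 0 < z.im ∧ 4 * t * invSqDist μ z = 1}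

section Static

variable {μ : Measure ℝ} [IsProbabilityMeasure μ] {R : ℝ}

lemma two_div_bound : ∀ δ > 0, ∀ C : ℝ, ∃ B : ℝ, ∀ x : ℂ, δ ≤ ‖x‖ → ‖x‖ ≤ C →
    ‖2 / x‖ ≤ B := by
  intro δ hδ C
  refine ⟨2 / δ, fun x hx _ => ?_⟩
  rw [norm_div, Complex.norm_ofNat]
  gcongr

lemma inv_sq_bound : ∀ δ > 0, ∀ C : ℝ, ∃ B : ℝ, ∀ x : ℂ, δ ≤ ‖x‖ → ‖x‖ ≤ C →
    ‖1 / ‖x‖ ^ 2‖ ≤ B := by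
  intro δ hδ C
  refine ⟨1 / δ ^ 2, fun x hx _ => ?_⟩
  rw [Real.norm_of_nonneg (by positivity)]
  gcongr

lemma log_bound : ∀ δ > 0, ∀ C : ℝ, ∃ B : ℝ, ∀ x : ℂ, δ ≤ ‖x‖ → ‖x‖ ≤ C →
    ‖2 * Complex.log x‖ ≤ B := by
  intro δ hδ C
  refine ⟨2 * (|Real.log δ| + |Real.log C| + Real.pi), fun x hx hC => ?_⟩
  rw [norm_mul, Complex.norm_ofNat]
  gcongr
  refine (Complex.norm_le_abs_re_add_abs_im _).trans ?_
  rw [Complex.log_re, Complex.log_im]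
  refine add_le_add ?_ (Complex.abs_arg_le_pi x)
  have h1 : Real.log δ ≤ Real.log ‖x‖ := Real.log_le_log hδ hx
  have h2 : Real.log ‖x‖ ≤ Real.log C := Real.log_le_log (hδ.trans_le hx) hC
  rw [abs_le]
  constructor <;> linarith [neg_abs_le (Real.log δ), le_abs_self (Real.log C),
    abs_nonneg (Real.log δ), abs_nonneg (Real.log C)]

lemma stronglyMeasurable_two_div : StronglyMeasurable (fun x : ℂ => 2 / x) :=
  (measurable_const.div measurable_id).stronglyMeasurable

lemma stronglyMeasurable_inv_sq : StronglyMeasurable (fun x : ℂ => 1 / ‖x‖ ^ 2) :=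
  (by fun_prop : Measurable (fun x : ℂ => 1 / ‖x‖ ^ 2)).stronglyMeasurable

lemma stronglyMeasurable_log : StronglyMeasurable (fun x : ℂ => 2 * Complex.log x) :=
  (by fun_prop : Measurable (fun x : ℂ => 2 * Complex.log x)).stronglyMeasurable

lemma integrable_two_div (hμ : ∀ᵐ u ∂μ, |u| ≤ R) {z : ℂ} (hz : z ∈ exteriorRegion R) :
    Integrable (fun u : ℝ => 2 / (z - (u : ℂ))) μ :=
  integrable_kernel hμ stronglyMeasurable_two_div two_div_bound hz

lemma integrable_inv_sq (hμ : ∀ᵐ u ∂μ, |u| ≤ R) {z : ℂ} (hz : z ∈ exteriorRegion R) :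
    Integrable (fun u : ℝ => 1 / ‖z - (u : ℂ)‖ ^ 2) μ :=
  integrable_kernel hμ stronglyMeasurable_inv_sq inv_sq_bound hz

lemma integrable_log (hμ : ∀ᵐ u ∂μ, |u| ≤ R) {z : ℂ} (hz : z ∈ exteriorRegion R) :
    Integrable (fun u : ℝ => 2 * Complex.log (z - (u : ℂ))) μ :=
  integrable_kernel hμ stronglyMeasurable_log log_bound hz

lemma continuousAt_cauchyTransform (hμ : ∀ᵐ u ∂μ, |u| ≤ R) {z : ℂ} (hz : z ∈ exteriorRegion R) :
    ContinuousAt (cauchyTransform μ) z := by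
  rw [← continuousWithinAt_univ]
  refine continuousWithinAt_integral_kernel hμ stronglyMeasurable_two_div two_div_bound
    (fun _ _ _ => mem_univ _) (fun x _ hx => ?_) hz (mem_univ z)
  exact (continuousAt_const.div continuousAt_id hx).continuousWithinAt

lemma continuousAt_invSqDist (hμ : ∀ᵐ u ∂μ, |u| ≤ R) {z : ℂ} (hz : z ∈ exteriorRegion R) :
    ContinuousAt (invSqDist μ) z := by
  rw [← continuousWithinAt_univ]
  refine continuousWithinAt_integral_kernel hμ stronglyMeasurable_inv_sq inv_sq_bound
    (fun _ _ _ => mem_univ _) (fun x _ hx => ?_) hz (mem_univ z)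
  exact (continuousAt_const.div (by fun_prop) (by simpa using hx)).continuousWithinAt

lemma continuousWithinAt_logPotential (hμ : ∀ᵐ u ∂μ, |u| ≤ R) {z : ℂ}
    (hz : z ∈ exteriorRegion R) (hz0 : 0 ≤ z.im) :
    ContinuousWithinAt (logPotential μ) {z | 0 ≤ z.im} z := by
  refine continuousWithinAt_integral_kernel hμ stronglyMeasurable_log log_bound
    (fun x hx u => by simpa using hx) (fun x hx hx0 => ?_) hz hz0
  refine continuousWithinAt_const.mul ?_
  by_cases hs : x ∈ Complex.slitPlane
  · exact (Complex.hasDerivAt_log hs).continuousAt.continuousWithinAt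
  · rw [Complex.mem_slitPlane_iff, not_or, not_lt, not_not] at hs
    refine Complex.continuousWithinAt_log_of_re_neg_of_im_zero (hs.1.lt_of_ne fun h => hx0 ?_) hs.2
    exact Complex.ext h hs.2

lemma mem_exteriorRegion_of_im_pos {z : ℂ} (hz : 0 < z.im) : z ∈ exteriorRegion R := Or.inl hz

lemma hasDerivAt_logPotential (hμ : ∀ᵐ u ∂μ, |u| ≤ R) {z : ℂ} (hz : 0 < z.im) :
    HasDerivAt (logPotential μ) (cauchyTransform μ z) z := by
  have hs : {y : ℂ | z.im / 2 < y.im} ∈ 𝓝 z :=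
    (isOpen_lt continuous_const Complex.continuous_im).mem_nhds (half_lt_self hz)
  have hb : ∀ᵐ u : ℝ ∂μ, ∀ y ∈ {y : ℂ | z.im / 2 < y.im},
      ‖2 / (y - (u : ℂ))‖ ≤ 2 / (z.im / 2) := by
    refine Eventually.of_forall fun u y hy => ?_
    rw [norm_div, Complex.norm_ofNat]
    have := im_le_norm_sub_ofReal y u
    simp only [mem_ofPred_eq] at hy
    gcongr
    linarith
  have hd : ∀ᵐ u : ℝ ∂μ, ∀ y ∈ {y : ℂ | z.im / 2 < y.im},
      HasDerivAt (fun y : ℂ => 2 * Complex.log (y - (u : ℂ))) (2 / (y - (u : ℂ))) y := by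
    refine Eventually.of_forall fun u y hy => ?_
    simp only [mem_ofPred_eq] at hy
    have hsl : y - (u : ℂ) ∈ Complex.slitPlane := Or.inr (by
      rw [sub_ofReal_im]; exact (lt_trans (by positivity) hy).ne')
    have := ((Complex.hasDerivAt_log hsl).comp y ((hasDerivAt_id y).sub_const (u : ℂ))).const_mul 2
    simpa [div_eq_mul_inv] using this
  have hm : ∀ y : ℂ, Measurable fun u : ℝ => 2 * Complex.log (y - (u : ℂ)) := by fun_prop
  have hm' : Measurable fun u : ℝ => 2 / (z - (u : ℂ)) := by fun_prop
  exact (hasDerivAt_integral_of_dominated_loc_of_deriv_le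
    (F := fun y u => 2 * Complex.log (y - ((u : ℝ) : ℂ)))
    (F' := fun y u => 2 / (y - ((u : ℝ) : ℂ))) (bound := fun _ => 2 / (z.im / 2)) hs
    (Eventually.of_forall fun y => (hm y).aestronglyMeasurable)
    (integrable_log hμ (mem_exteriorRegion_of_im_pos hz))
    hm'.aestronglyMeasurable hb (integrable_const _) hd).2

lemma hasDerivAt_cauchyTransform (hμ : ∀ᵐ u ∂μ, |u| ≤ R) {z : ℂ} (hz : 0 < z.im) :
    HasDerivAt (cauchyTransform μ) (-(2 * ∫ u : ℝ, 1 / ((z - (u : ℂ)) * (z - u)) ∂μ)) z := by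
  have hs : {y : ℂ | z.im / 2 < y.im} ∈ 𝓝 z :=
    (isOpen_lt continuous_const Complex.continuous_im).mem_nhds (half_lt_self hz)
  have hb : ∀ᵐ u : ℝ ∂μ, ∀ y ∈ {y : ℂ | z.im / 2 < y.im},
      ‖-(2 * (1 / ((y - (u : ℂ)) * (y - u))))‖ ≤ 2 / (z.im / 2) ^ 2 := by
    refine Eventually.of_forall fun u y hy => ?_
    rw [norm_neg, norm_mul, norm_div, norm_mul, Complex.norm_ofNat, norm_one, ← pow_two]
    have := im_le_norm_sub_ofReal y u
    simp only [mem_ofPred_eq] at hy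
    rw [mul_one_div]
    gcongr
    linarith
  have hd : ∀ᵐ u : ℝ ∂μ, ∀ y ∈ {y : ℂ | z.im / 2 < y.im},
      HasDerivAt (fun y : ℂ => 2 / (y - (u : ℂ))) (-(2 * (1 / ((y - (u : ℂ)) * (y - u))))) y := by
    refine Eventually.of_forall fun u y hy => ?_
    simp only [mem_ofPred_eq] at hy
    have h0 : y - (u : ℂ) ≠ 0 := sub_ne_zero_of_mem_exteriorRegion (R := |u|)
      (mem_exteriorRegion_of_im_pos (lt_trans (by positivity) hy)) le_rfl
    refine ((hasDerivAt_const y (2 : ℂ)).div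
      ((hasDerivAt_id y).sub_const (u : ℂ)) h0).congr_deriv ?_
    simp only [id]
    field_simp
    ring
  have hm : Measurable fun u : ℝ => -(2 * (1 / ((z - (u : ℂ)) * (z - u)))) := by fun_prop
  have hm' : ∀ y : ℂ, Measurable fun u : ℝ => 2 / (y - (u : ℂ)) := by fun_prop
  have key := (hasDerivAt_integral_of_dominated_loc_of_deriv_le
    (F := fun y u => 2 / (y - ((u : ℝ) : ℂ)))
    (F' := fun y u => -(2 * (1 / ((y - ((u : ℝ) : ℂ)) * (y - u)))))
    (bound := fun _ => 2 / (z.im / 2) ^ 2) hs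
    (Eventually.of_forall fun y => (hm' y).aestronglyMeasurable)
    (integrable_two_div hμ (mem_exteriorRegion_of_im_pos hz))
    hm.aestronglyMeasurable hb (integrable_const _) hd).2
  rw [integral_neg, integral_const_mul] at key
  exact key

lemma im_cauchyTransform (hμ : ∀ᵐ u ∂μ, |u| ≤ R) {z : ℂ} (hz : z ∈ exteriorRegion R) :
    (cauchyTransform μ z).im = -(2 * z.im * invSqDist μ z) := by
  unfold cauchyTransform invSqDist
  rw [← RCLike.im_eq_complex_im, ← integral_im (integrable_two_div hμ hz), ← integral_const_mul,
    ← integral_neg]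
  congr 1
  ext u
  simp only [RCLike.im_to_complex, Complex.div_im, Complex.normSq_eq_norm_sq]
  simp
  ring

lemma im_charMap (hμ : ∀ᵐ u ∂μ, |u| ≤ R) (t : ℝ) {z : ℂ} (hz : z ∈ exteriorRegion R) :
    (charMap μ t z).im = z.im * (1 - 4 * t * invSqDist μ z) := by
  have : (2 * (t : ℂ)) = ((2 * t : ℝ) : ℂ) := by push_cast; rfl
  rw [charMap, this, Complex.add_im, Complex.im_ofReal_mul, im_cauchyTransform hμ hz]
  ring

lemma invSqDist_lt (hμ : ∀ᵐ u ∂μ, |u| ≤ R) {z w : ℂ} (hz : z ∈ exteriorRegion R)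
    (hw : w ∈ exteriorRegion R) (h : ∀ u : ℝ, |u| ≤ R → ‖z - (u : ℂ)‖ < ‖w - (u : ℂ)‖) :
    invSqDist μ w < invSqDist μ z := by
  rw [← sub_pos, invSqDist, invSqDist,
    ← integral_sub (integrable_inv_sq hμ hz) (integrable_inv_sq hμ hw)]
  refine integral_pos_of_ae_pos ((integrable_inv_sq hμ hz).sub (integrable_inv_sq hμ hw)) ?_
  filter_upwards [hμ] with u hu
  have h1 : 0 < ‖z - (u : ℂ)‖ := norm_pos_iff.2 (sub_ne_zero_of_mem_exteriorRegion hz hu)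
  have h2 := h u hu
  rw [sub_pos]
  gcongr

lemma invSqDist_pos (hμ : ∀ᵐ u ∂μ, |u| ≤ R) {z : ℂ} (hz : z ∈ exteriorRegion R) :
    0 < invSqDist μ z := by
  refine integral_pos_of_ae_pos (integrable_inv_sq hμ hz) ?_
  filter_upwards [hμ] with u hu
  have h1 : 0 < ‖z - (u : ℂ)‖ := norm_pos_iff.2 (sub_ne_zero_of_mem_exteriorRegion hz hu)
  positivity

lemma invSqDist_le (hμ : ∀ᵐ u ∂μ, |u| ≤ R) {z : ℂ} (hz : z ∈ exteriorRegion R) {δ : ℝ}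
    (hδ : 0 < δ) (h : ∀ u : ℝ, |u| ≤ R → δ ≤ ‖z - (u : ℂ)‖) : invSqDist μ z ≤ 1 / δ ^ 2 := by
  have : ∫ _ : ℝ, 1 / δ ^ 2 ∂μ = 1 / δ ^ 2 := by simp
  rw [← this]
  refine integral_mono_ae (integrable_inv_sq hμ hz) (integrable_const _) ?_
  filter_upwards [hμ] with u hu
  have := h u hu
  gcongr

lemma le_invSqDist (hμ : ∀ᵐ u ∂μ, |u| ≤ R) {z : ℂ} (hz : z ∈ exteriorRegion R) {C : ℝ}
    (h : ∀ u : ℝ, |u| ≤ R → ‖z - (u : ℂ)‖ ≤ C) : 1 / C ^ 2 ≤ invSqDist μ z := by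
  have : ∫ _ : ℝ, 1 / C ^ 2 ∂μ = 1 / C ^ 2 := by simp
  rw [← this]
  refine integral_mono_ae (integrable_const _) (integrable_inv_sq hμ hz) ?_
  filter_upwards [hμ] with u hu
  have h1 : 0 < ‖z - (u : ℂ)‖ := norm_pos_iff.2 (sub_ne_zero_of_mem_exteriorRegion hz hu)
  have := h u hu
  gcongr

lemma im_cauchyTransform_neg (hμ : ∀ᵐ u ∂μ, |u| ≤ R) {z : ℂ} (hz : 0 < z.im) :
    (cauchyTransform μ z).im < 0 := by
  have hz' : z ∈ exteriorRegion R := Or.inl hz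
  rw [im_cauchyTransform hμ hz']
  have := invSqDist_pos hμ hz'
  have : 0 < 2 * z.im * invSqDist μ z := by positivity
  linarith

lemma cauchyTransform_ne_zero (hμ : ∀ᵐ u ∂μ, |u| ≤ R) {z : ℂ} (hz : 0 < z.im) :
    cauchyTransform μ z ≠ 0 := by
  intro h
  have := im_cauchyTransform_neg hμ hz
  simp [h] at this

/-- The Cauchy–Schwarz inequality. -/
lemma norm_cauchyTransform_sq_le (hμ : ∀ᵐ u ∂μ, |u| ≤ R) {z : ℂ} (hz : z ∈ exteriorRegion R) :
    ‖cauchyTransform μ z‖ ^ 2 ≤ 4 * invSqDist μ z := by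
  have hi := (integrable_two_div hμ hz).norm
  have hk := integrable_inv_sq hμ hz
  set m := ∫ u : ℝ, ‖2 / (z - (u : ℂ))‖ ∂μ with hm
  have h1 : ‖cauchyTransform μ z‖ ≤ m := norm_integral_le_integral_norm _
  have h2 : 0 ≤ ∫ u : ℝ, (‖2 / (z - (u : ℂ))‖ - m) ^ 2 ∂μ :=
    integral_nonneg fun u => sq_nonneg _
  have h3 : ∀ u : ℝ, (‖2 / (z - (u : ℂ))‖ - m) ^ 2 =
      4 * (1 / ‖z - (u : ℂ)‖ ^ 2) - 2 * m * ‖2 / (z - (u : ℂ))‖ + m ^ 2 := by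
    intro u
    rw [norm_div, Complex.norm_ofNat]
    ring
  have h5 : ∫ u : ℝ, (‖2 / (z - (u : ℂ))‖ - m) ^ 2 ∂μ =
      4 * invSqDist μ z - 2 * m * m + m ^ 2 := by
    have hA := hk.const_mul 4
    have hB := hi.const_mul (2 * m)
    have hAB : Integrable (fun u : ℝ =>
      4 * (1 / ‖z - (u : ℂ)‖ ^ 2) - 2 * m * ‖2 / (z - (u : ℂ))‖) μ := hA.sub hB
    simp_rw [h3]
    rw [integral_add hAB (integrable_const _), integral_sub hA hB, integral_const_mul,
      integral_const_mul, ← hm, invSqDist]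
    simp
  rw [h5] at h2
  have h4 : 0 ≤ ‖cauchyTransform μ z‖ := norm_nonneg _
  have : ‖cauchyTransform μ z‖ ^ 2 ≤ m ^ 2 := by gcongr
  nlinarith

lemma integrable_inv_mul {z w : ℂ} (hz : 0 < z.im) (hw : 0 < w.im) :
    Integrable (fun u : ℝ => 1 / ((z - (u : ℂ)) * (w - u))) μ := by
  refine Integrable.mono' (integrable_const (1 / (z.im * w.im)))
    (by fun_prop : Measurable _).aestronglyMeasurable (Eventually.of_forall fun u => ?_)
  rw [norm_div, norm_one, norm_mul]
  have := im_le_norm_sub_ofReal z u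
  have := im_le_norm_sub_ofReal w u
  gcongr

/-- The strict inequality comes from `(|a|² + |b|²) / 2 - Re (a b) = |a - conj b|² / 2` for
`a = 1 / (z - u)` and `b = 1 / (w - u)`, which both lie in the lower half-plane. -/
lemma re_integral_inv_mul_lt (hμ : ∀ᵐ u ∂μ, |u| ≤ R) {z w : ℂ} (hz : 0 < z.im) (hw : 0 < w.im) :
    (∫ u : ℝ, 1 / ((z - (u : ℂ)) * (w - u)) ∂μ).re < (invSqDist μ z + invSqDist μ w) / 2 := by
  have hi := integrable_inv_mul (μ := μ) hz hw
  have hkz := integrable_inv_sq hμ (mem_exteriorRegion_of_im_pos (R := R) hz)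
  have hkw := integrable_inv_sq hμ (mem_exteriorRegion_of_im_pos (R := R) hw)
  have hre : (∫ u : ℝ, 1 / ((z - (u : ℂ)) * (w - u)) ∂μ).re =
      ∫ u : ℝ, (1 / ((z - (u : ℂ)) * (w - u))).re ∂μ := by
    rw [← RCLike.re_eq_complex_re, ← integral_re hi]
  have hire : Integrable (fun u : ℝ => (1 / ((z - (u : ℂ)) * (w - u))).re) μ := hi.re
  have hk : Integrable (fun u : ℝ =>
      (1 / ‖z - (u : ℂ)‖ ^ 2 + 1 / ‖w - (u : ℂ)‖ ^ 2) / 2) μ := (hkz.add hkw).div_const 2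
  rw [hre, ← sub_pos, invSqDist, invSqDist, ← integral_add hkz hkw, ← integral_div,
    ← integral_sub hk hire]
  refine integral_pos_of_ae_pos (hk.sub hire) (Eventually.of_forall fun u => ?_)
  have key : ∀ a b : ℂ, (‖a‖ ^ 2 + ‖b‖ ^ 2) / 2 - (a * b).re = ‖a - conj b‖ ^ 2 / 2 := by
    intro a b
    rw [← Complex.normSq_eq_norm_sq, ← Complex.normSq_eq_norm_sq, ← Complex.normSq_eq_norm_sq]
    simp only [Complex.normSq_apply, Complex.mul_re, Complex.sub_re, Complex.sub_im,
      Complex.conj_re, Complex.conj_im]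
    ring
  have h2 := key (1 / (z - u)) (1 / (w - u))
  rw [norm_div, norm_div, norm_one, div_pow, div_pow, one_pow, div_mul_div_comm, one_mul] at h2
  rw [h2]
  have hne : 1 / (z - (u : ℂ)) - conj (1 / (w - (u : ℂ))) ≠ 0 := by
    intro h
    have him : ∀ x : ℂ, 0 < x.im → (1 / (x - (u : ℂ))).im < 0 := by
      intro x hx
      have h0 : x - (u : ℂ) ≠ 0 := sub_ne_zero_of_mem_exteriorRegion (R := |u|)
        (mem_exteriorRegion_of_im_pos hx) le_rfl
      rw [one_div, Complex.inv_im, sub_ofReal_im]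
      exact div_neg_of_neg_of_pos (by linarith) (Complex.normSq_pos.2 h0)
    have := congrArg Complex.im h
    rw [Complex.sub_im, Complex.conj_im, Complex.zero_im] at this
    linarith [him z hz, him w hw]
  positivity

lemma cauchyTransform_sub (hμ : ∀ᵐ u ∂μ, |u| ≤ R) {z w : ℂ} (hz : 0 < z.im) (hw : 0 < w.im) :
    cauchyTransform μ z - cauchyTransform μ w =
      -(2 * (z - w) * ∫ u : ℝ, 1 / ((z - (u : ℂ)) * (w - u)) ∂μ) := by
  rw [cauchyTransform, cauchyTransform,
    ← integral_sub (integrable_two_div hμ (mem_exteriorRegion_of_im_pos hz))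
    (integrable_two_div hμ (mem_exteriorRegion_of_im_pos hw)), ← integral_const_mul, ← integral_neg]
  congr 1
  ext u
  have h0 : z - (u : ℂ) ≠ 0 := sub_ne_zero_of_mem_exteriorRegion (R := |u|)
    (mem_exteriorRegion_of_im_pos hz) le_rfl
  have h1 : w - (u : ℂ) ≠ 0 := sub_ne_zero_of_mem_exteriorRegion (R := |u|)
    (mem_exteriorRegion_of_im_pos hw) le_rfl
  field_simp
  ring

/-- `charMap μ t` is injective on the union of `charDomain μ t` and `charCurve μ t`. -/
lemma charMap_injOn (hμ : ∀ᵐ u ∂μ, |u| ≤ R) {t : ℝ} (ht : 0 ≤ t) :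
    InjOn (charMap μ t) {z | 0 < z.im ∧ 4 * t * invSqDist μ z ≤ 1} := by
  rintro z ⟨hz, hz1⟩ w ⟨hw, hw1⟩ h
  by_contra hne
  have h1 := cauchyTransform_sub hμ hz hw
  have h2 := re_integral_inv_mul_lt hμ hz hw
  set J := ∫ u : ℝ, 1 / ((z - (u : ℂ)) * (w - u)) ∂μ
  simp only [charMap] at h
  have h3 : (z - w) * (1 - 4 * t * J) = 0 := by linear_combination h - 2 * t * h1
  have h4 : 1 - 4 * t * J = 0 := (mul_eq_zero.1 h3).resolve_left (sub_ne_zero.2 hne)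
  have h5 : (4 * (t : ℂ)) = ((4 * t : ℝ) : ℂ) := by push_cast; rfl
  have h6 := congrArg Complex.re h4
  rw [h5, Complex.sub_re, Complex.re_ofReal_mul, Complex.one_re, Complex.zero_re] at h6
  rcases ht.eq_or_lt with rfl | ht
  · simp at h6
  · nlinarith [mul_lt_mul_of_pos_left h2 (show 0 < 4 * t by positivity)]

/-- The derivative of `charMap μ t`. -/
def charMapDeriv (μ : Measure ℝ) (t : ℝ) (z : ℂ) : ℂ :=
  1 + 2 * t * -(2 * ∫ u : ℝ, 1 / ((z - (u : ℂ)) * (z - u)) ∂μ)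

lemma hasDerivAt_charMap (hμ : ∀ᵐ u ∂μ, |u| ≤ R) (t : ℝ) {z : ℂ} (hz : 0 < z.im) :
    HasDerivAt (charMap μ t) (charMapDeriv μ t z) z :=
  (hasDerivAt_id z).add ((hasDerivAt_cauchyTransform hμ hz).const_mul (2 * (t : ℂ)))

lemma charMapDeriv_ne_zero (hμ : ∀ᵐ u ∂μ, |u| ≤ R) {t : ℝ} (ht : 0 ≤ t) {z : ℂ} (hz : 0 < z.im)
    (h : 4 * t * invSqDist μ z ≤ 1) : charMapDeriv μ t z ≠ 0 := by
  intro h4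
  have h2 := re_integral_inv_mul_lt hμ hz hz
  rw [charMapDeriv] at h4
  set J := ∫ u : ℝ, 1 / ((z - (u : ℂ)) * (z - u)) ∂μ
  have h5 : 1 + 2 * (t : ℂ) * -(2 * J) = 1 - ((4 * t : ℝ) : ℂ) * J := by push_cast; ring
  have h6 := congrArg Complex.re h4
  rw [h5, Complex.sub_re, Complex.re_ofReal_mul, Complex.one_re, Complex.zero_re] at h6
  rcases ht.eq_or_lt with rfl | ht
  · simp at h6
  · nlinarith [mul_lt_mul_of_pos_left h2 (show 0 < 4 * t by positivity)]

lemma hasDerivAt_potentialMap (hμ : ∀ᵐ u ∂μ, |u| ≤ R) (t : ℝ) {z : ℂ} (hz : 0 < z.im) :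
    HasDerivAt (potentialMap μ t) (cauchyTransform μ z * charMapDeriv μ t z) z := by
  refine ((hasDerivAt_logPotential hμ hz).add
    (((hasDerivAt_cauchyTransform hμ hz).pow 2).const_mul (t : ℂ))).congr_deriv ?_
  simp only [charMapDeriv]
  push_cast
  ring

lemma hasStrictDerivAt_of_im_pos {f f' : ℂ → ℂ} (h : ∀ z : ℂ, 0 < z.im → HasDerivAt f (f' z) z)
    {z : ℂ} (hz : 0 < z.im) : HasStrictDerivAt f (f' z) z ∧ AnalyticAt ℂ f z := by
  have ho : IsOpen {z : ℂ | 0 < z.im} := isOpen_lt continuous_const Complex.continuous_im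
  have hd : DifferentiableOn ℂ f {z : ℂ | 0 < z.im} :=
    fun y hy => (h y hy).differentiableAt.differentiableWithinAt
  have ha : AnalyticAt ℂ f z := hd.analyticAt (ho.mem_nhds hz)
  refine ⟨?_, ha⟩
  rw [← (h z hz).deriv]
  exact ha.hasStrictDerivAt

/-- The derivative of the potential has negative imaginary part, which makes it injective on the
convex set `{0 < im}`. -/
lemma logPotential_injOn (hμ : ∀ᵐ u ∂μ, |u| ≤ R) : InjOn (logPotential μ) {z | 0 < z.im} := by
  intro z hz w hw h
  by_contra hne
  have hne' : w - z ≠ 0 := sub_ne_zero.2 (Ne.symm hne)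
  have hseg : ∀ s ∈ Icc (0 : ℝ) 1, 0 < (z + s * (w - z)).im := by
    intro s hs
    have h1 : (z + s * (w - z)).im = (1 - s) * z.im + s * w.im := by
      rw [Complex.add_im, Complex.im_ofReal_mul, Complex.sub_im]; ring
    rw [h1]
    simp only [mem_ofPred_eq] at hz hw
    rcases hs.1.eq_or_lt with rfl | h0
    · simpa using hz
    · have := mul_pos h0 hw
      have := mul_nonneg (sub_nonneg.2 hs.2) hz.le
      linarith
  have hd : ∀ s ∈ Icc (0 : ℝ) 1, HasDerivAt
      (fun s : ℝ => (logPotential μ (z + s * (w - z)) / (w - z)).im)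
      (cauchyTransform μ (z + s * (w - z))).im s := by
    intro s hs
    have h1 : HasDerivAt (fun s : ℝ => z + (s : ℂ) * (w - z)) (w - z) s := by
      simpa using ((Complex.ofRealCLM.hasDerivAt (x := s)).mul_const (w - z)).const_add z
    have h2 := ((hasDerivAt_logPotential hμ (hseg s hs)).comp s h1).div_const (w - z)
    rw [mul_div_assoc, div_self hne', mul_one] at h2
    exact Complex.imCLM.hasFDerivAt.comp_hasDerivAt s h2
  obtain ⟨c, hc, hc'⟩ := exists_hasDerivAt_eq_slope _ _ zero_lt_one
    (fun s hs => (hd s hs).continuousAt.continuousWithinAt)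
    (fun s hs => hd s (Ioo_subset_Icc_self hs))
  have := im_cauchyTransform_neg hμ (hseg c (Ioo_subset_Icc_self hc))
  simp [h] at hc'
  linarith

lemma re_logPotential (hμ : ∀ᵐ u ∂μ, |u| ≤ R) {z : ℂ} (hz : z ∈ exteriorRegion R) :
    (logPotential μ z).re = ∫ u : ℝ, 2 * Real.log ‖z - (u : ℂ)‖ ∂μ := by
  unfold logPotential
  rw [← RCLike.re_eq_complex_re, ← integral_re (integrable_log hμ hz)]
  simp [Complex.log_re]

lemma im_logPotential (hμ : ∀ᵐ u ∂μ, |u| ≤ R) {z : ℂ} (hz : z ∈ exteriorRegion R) :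
    (logPotential μ z).im = ∫ u : ℝ, 2 * Complex.arg (z - (u : ℂ)) ∂μ := by
  unfold logPotential
  rw [← RCLike.im_eq_complex_im, ← integral_im (integrable_log hμ hz)]
  simp [Complex.log_im]

lemma integrable_log_norm (hμ : ∀ᵐ u ∂μ, |u| ≤ R) {z : ℂ} (hz : z ∈ exteriorRegion R) :
    Integrable (fun u : ℝ => 2 * Real.log ‖z - (u : ℂ)‖) μ := by
  have := (integrable_log hμ hz).re
  simpa [Complex.log_re] using this

lemma integrable_arg (hμ : ∀ᵐ u ∂μ, |u| ≤ R) {z : ℂ} (hz : z ∈ exteriorRegion R) :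
    Integrable (fun u : ℝ => 2 * Complex.arg (z - (u : ℂ))) μ := by
  have := (integrable_log hμ hz).im
  simpa [Complex.log_im] using this

lemma re_logPotential_le (hμ : ∀ᵐ u ∂μ, |u| ≤ R) {z : ℂ} (hz : z ∈ exteriorRegion R) :
    (logPotential μ z).re ≤ 2 * Real.log (‖z‖ + R) := by
  have : ∫ _ : ℝ, 2 * Real.log (‖z‖ + R) ∂μ = 2 * Real.log (‖z‖ + R) := by simp
  rw [re_logPotential hμ hz, ← this]
  refine integral_mono_ae (integrable_log_norm hμ hz) (integrable_const _) ?_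
  filter_upwards [hμ] with u hu
  have h1 : 0 < ‖z - (u : ℂ)‖ := norm_pos_iff.2 (sub_ne_zero_of_mem_exteriorRegion hz hu)
  have := Real.log_le_log h1 (norm_sub_ofReal_le z hu)
  linarith

lemma le_re_logPotential (hμ : ∀ᵐ u ∂μ, |u| ≤ R) {z : ℂ} (hz : R < ‖z‖) :
    2 * Real.log (‖z‖ - R) ≤ (logPotential μ z).re := by
  have : ∫ _ : ℝ, 2 * Real.log (‖z‖ - R) ∂μ = 2 * Real.log (‖z‖ - R) := by simp
  rw [re_logPotential hμ (Or.inr hz), ← this]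
  refine integral_mono_ae (integrable_const _) (integrable_log_norm hμ (Or.inr hz)) ?_
  filter_upwards [hμ] with u hu
  have := Real.log_le_log (sub_pos.2 hz) (norm_sub_le_norm_sub_ofReal z hu)
  linarith

lemma im_logPotential_mem_Ioo (hμ : ∀ᵐ u ∂μ, |u| ≤ R) {z : ℂ} (hz : 0 < z.im) :
    (logPotential μ z).im ∈ Ioo 0 (2 * Real.pi) := by
  have hz' : z ∈ exteriorRegion R := Or.inl hz
  have harg : ∀ u : ℝ, 0 < Complex.arg (z - u) ∧ Complex.arg (z - u) < Real.pi := by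
    intro u
    have h0 : 0 < (z - (u : ℂ)).im := by rw [sub_ofReal_im]; exact hz
    refine ⟨lt_of_le_of_ne (Complex.arg_nonneg_iff.2 h0.le) fun h => ?_,
      lt_of_le_of_ne (Complex.arg_le_pi _) fun h => ?_⟩
    · exact h0.ne' (Complex.arg_eq_zero_iff.1 h.symm).2
    · exact h0.ne' (Complex.arg_eq_pi_iff.1 h).2
  rw [im_logPotential hμ hz']
  refine ⟨integral_pos_of_ae_pos (integrable_arg hμ hz') (Eventually.of_forall fun u => ?_), ?_⟩
  · linarith [harg u]
  · have : ∫ _ : ℝ, 2 * Real.pi ∂μ = 2 * Real.pi := by simp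
    rw [← sub_pos]
    nth_rw 1 [← this]
    rw [← integral_sub (integrable_const _) (integrable_arg hμ hz')]
    refine integral_pos_of_ae_pos ((integrable_const _).sub (integrable_arg hμ hz'))
      (Eventually.of_forall fun u => ?_)
    linarith [harg u]

/-- On the real line outside `[-R, R]`, the potential from above has imaginary part `0` on the right
and `2 π` on the left. -/
lemma im_logPotential_of_im_eq_zero (hμ : ∀ᵐ u ∂μ, |u| ≤ R) {z : ℂ} (hz : R < ‖z‖)
    (hz0 : z.im = 0) : (logPotential μ z).im = 0 ∨ (logPotential μ z).im = 2 * Real.pi := by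
  have hn : ‖z‖ = |z.re| := by
    rw [show z = (z.re : ℂ) from Complex.ext rfl (by simpa using hz0), Complex.norm_real]
    simp
  rw [im_logPotential hμ (Or.inr hz)]
  rw [hn] at hz
  rcases lt_abs.1 hz with h | h
  · left
    rw [← integral_zero ℝ ℝ (μ := μ)]
    refine integral_congr_ae ?_
    filter_upwards [hμ] with u hu
    have : Complex.arg (z - u) = 0 := by
      rw [Complex.arg_eq_zero_iff, sub_ofReal_im]
      refine ⟨?_, hz0⟩
      simp only [Complex.sub_re, Complex.ofReal_re]
      linarith [le_abs_self u]
    simp [this]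
  · right
    have : ∫ _ : ℝ, 2 * Real.pi ∂μ = 2 * Real.pi := by simp
    rw [← this]
    refine integral_congr_ae ?_
    filter_upwards [hμ] with u hu
    have : Complex.arg (z - u) = Real.pi := by
      rw [Complex.arg_eq_pi_iff, sub_ofReal_im]
      refine ⟨?_, hz0⟩
      simp only [Complex.sub_re, Complex.ofReal_re]
      linarith [neg_abs_le u]
    simp [this]

lemma im_potentialMap_of_im_eq_zero (hμ : ∀ᵐ u ∂μ, |u| ≤ R) (t : ℝ) {z : ℂ} (hz : R < ‖z‖)
    (hz0 : z.im = 0) : (potentialMap μ t z).im = 0 ∨ (potentialMap μ t z).im = 2 * Real.pi := by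
  have h1 : (cauchyTransform μ z).im = 0 := by
    rw [im_cauchyTransform hμ (Or.inr hz), hz0]; simp
  have h2 : (potentialMap μ t z).im = (logPotential μ z).im := by
    rw [potentialMap, Complex.add_im, Complex.im_ofReal_mul, pow_two, Complex.mul_im, h1]
    simp
  rw [h2]
  exact im_logPotential_of_im_eq_zero hμ hz hz0

lemma norm_mul_cauchyTransform_sq_le (hμ : ∀ᵐ u ∂μ, |u| ≤ R) {t : ℝ} (ht : 0 ≤ t) {z : ℂ}
    (hz : z ∈ exteriorRegion R) (h : 4 * t * invSqDist μ z ≤ 1) :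
    ‖(t : ℂ) * cauchyTransform μ z ^ 2‖ ≤ 1 := by
  rw [norm_mul, norm_pow, Complex.norm_real, Real.norm_of_nonneg ht]
  nlinarith [mul_le_mul_of_nonneg_left (norm_cauchyTransform_sq_le hμ hz) ht]

lemma abs_re_potentialMap_sub_le (hμ : ∀ᵐ u ∂μ, |u| ≤ R) {t : ℝ} (ht : 0 ≤ t) {z : ℂ}
    (hz : z ∈ exteriorRegion R) (h : 4 * t * invSqDist μ z ≤ 1) :
    |(potentialMap μ t z).re - (logPotential μ z).re| ≤ 1 := by
  rw [potentialMap, Complex.add_re, add_sub_cancel_left]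
  exact (Complex.abs_re_le_norm _).trans (norm_mul_cauchyTransform_sq_le hμ ht hz h)

/-- The constant `2` is an upper bound for `exp (1 / 2)`. -/
lemma le_two_mul_of_log_le {a b : ℝ} (ha : 0 < a) (hb : 0 < b)
    (h : 2 * Real.log a ≤ 2 * Real.log b + 1) : a ≤ 2 * b := by
  have h2 : (1 : ℝ) / 2 ≤ Real.log 2 := by linarith [Real.log_two_gt_d9]
  rw [← Real.log_le_log_iff ha (by positivity), Real.log_mul (by norm_num) hb.ne']
  linarith

/-- The two points matched by `logPotential μ z = potentialMap μ t ζ` have comparable moduli. -/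
lemma norm_le_of_re_eq (hμ : ∀ᵐ u ∂μ, |u| ≤ R) (hR : 0 ≤ R) {t : ℝ} (ht : 0 ≤ t) {z ζ : ℂ}
    (hz : z ∈ exteriorRegion R) (hζ : ζ ∈ exteriorRegion R) (hk : 4 * t * invSqDist μ ζ ≤ 1)
    (h : (logPotential μ z).re = (potentialMap μ t ζ).re) :
    ‖z‖ ≤ 2 * (‖ζ‖ + R) + R ∧ ‖ζ‖ ≤ 2 * (‖z‖ + R) + R := by
  have h1 := abs_le.1 (abs_re_potentialMap_sub_le hμ ht hζ hk)
  have hne : ∀ x ∈ exteriorRegion R, 0 < ‖x‖ + R := by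
    intro x hx
    have := norm_pos_iff.2 (sub_ne_zero_of_mem_exteriorRegion hx (u := 0) (by simpa using hR))
    simp at this
    positivity
  constructor
  · rcases le_or_gt ‖z‖ R with h2 | h2
    · linarith [norm_nonneg ζ]
    · have h3 := le_re_logPotential hμ h2
      have h4 := re_logPotential_le hμ hζ
      have := le_two_mul_of_log_le (sub_pos.2 h2) (hne ζ hζ) (by linarith)
      linarith
  · rcases le_or_gt ‖ζ‖ R with h2 | h2
    · linarith [norm_nonneg z]
    · have h3 := le_re_logPotential hμ h2
      have h4 := re_logPotential_le hμ hz
      have := le_two_mul_of_log_le (sub_pos.2 h2) (hne z hz) (by linarith)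
      linarith

end Static

/-! ### Characteristics of the Burgers equation -/

section Characteristics

variable {μ : Measure ℝ} {M : ℝ → ℂ → ℂ}

lemma isOpen_im_pos : IsOpen {z : ℂ | 0 < z.im} :=
  isOpen_lt continuous_const Complex.continuous_im

/-- Locally uniform limits of holomorphic functions can be differentiated, so the space derivative
of a solution is jointly continuous. -/
lemma IsBurgersSolution.continuousOn_deriv (hM : IsBurgersSolution μ M) :
    ContinuousOn (fun p : ℝ × ℂ => deriv (M p.1) p.2) (Ici (0 : ℝ) ×ˢ {z : ℂ | 0 < z.im}) := by
  rintro ⟨s, z⟩ ⟨hs, hz⟩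
  simp only at hs hz
  set φ := 𝓝[Ici (0 : ℝ) ×ˢ {z : ℂ | 0 < z.im}] (s, z) with hφ
  have hfst : Tendsto Prod.fst φ (𝓝[Ici 0] s) := by
    rw [hφ, nhdsWithin_prod_eq]; exact tendsto_fst
  have hsnd : Tendsto Prod.snd φ (𝓝[{z : ℂ | 0 < z.im}] z) := by
    rw [hφ, nhdsWithin_prod_eq]; exact tendsto_snd
  have hloc : TendstoLocallyUniformlyOn (fun (p : ℝ × ℂ) (x : ℂ) => M p.1 x) (M s) φ
      {z : ℂ | 0 < z.im} := by
    rw [Metric.tendstoLocallyUniformlyOn_iff]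
    intro ε hε x hx
    have h1 := hM.continuousOn (s, x) ⟨hs, hx⟩
    have h2 := h1.eventually (Metric.ball_mem_nhds _ (half_pos hε))
    rw [nhdsWithin_prod_eq, eventually_prod_iff] at h2
    obtain ⟨pa, ha, pb, hb, hab⟩ := h2
    refine ⟨{y | pb y}, hb, ?_⟩
    filter_upwards [hfst.eventually ha] with p hp y hy
    have h3 := Metric.mem_ball.1 (hab hp hy)
    have h4 := Metric.mem_ball.1 (hab (ha.self_of_nhdsWithin hs) hy)
    calc dist (M s y) (M p.1 y) ≤ dist (M s y) (M s x) + dist (M p.1 y) (M s x) :=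
          dist_triangle_right _ _ _
      _ < ε / 2 + ε / 2 := add_lt_add h4 h3
      _ = ε := by ring
  have hev : ∀ᶠ p in φ, DifferentiableOn ℂ (fun x => M p.1 x) {z : ℂ | 0 < z.im} := by
    filter_upwards [hfst self_mem_nhdsWithin] with p hp
    exact hM.differentiableOn _ hp
  have hd := hloc.deriv hev isOpen_im_pos
  have hc : ContinuousWithinAt (deriv (M s)) {z : ℂ | 0 < z.im} z :=
    ((hM.differentiableOn s hs).deriv isOpen_im_pos).continuousOn z hz
  exact hd.tendsto_comp hc hz hsnd

/-- The chain rule for a solution along a differentiable path. -/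
lemma IsBurgersSolution.hasDerivWithinAt_comp (hM : IsBurgersSolution μ M) {S : Set ℝ}
    (hS : S ⊆ Ici 0) {s : ℝ} (hs : s ∈ S) {y : ℝ → ℂ} {y' : ℂ} (hy : HasDerivWithinAt y y' S s)
    (him : 0 < (y s).im) :
    HasDerivWithinAt (fun r => M r (y r))
      (-2 * M s (y s) * deriv (M s) (y s) + deriv (M s) (y s) * y') S s := by
  set D := deriv (M s) (y s) with hD
  have h1 : HasDerivWithinAt (fun r => M r (y s)) (-2 * M s (y s) * D) S s :=
    (hM.burgers s (hS hs) (y s) him).mono hS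
  have h2 : HasDerivWithinAt (fun r => D * (y r - y s)) (D * y') S s :=
    (hy.sub_const _).const_mul D
  have h3 : HasDerivWithinAt (fun r => M r (y r) - M r (y s) - D * (y r - y s)) 0 S s := by
    rw [hasDerivWithinAt_iff_isLittleO]
    have hO : (fun r => y r - y s) =O[𝓝[S] s] fun r => r - s :=
      hy.isBigO_sub.comp_tendsto
        (tendsto_id.prodMk (tendsto_pure.2 (Eventually.of_forall fun _ => rfl)))
    simp only [sub_self, mul_zero, smul_zero, sub_zero]
    refine Asymptotics.IsLittleO.trans_isBigO ?_ hO
    rw [Asymptotics.isLittleO_iff]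
    intro c hc
    have hcont := (hM.continuousOn_deriv (s, y s) ⟨hS hs, him⟩).eventually
      (Metric.ball_mem_nhds _ hc)
    rw [nhdsWithin_prod_eq, eventually_prod_iff] at hcont
    obtain ⟨pa, ha, pb, hb, hab⟩ := hcont
    rw [isOpen_im_pos.nhdsWithin_eq him] at hb
    obtain ⟨ρ, hρ, hball⟩ := Metric.mem_nhds_iff.1
      (Filter.inter_mem hb (isOpen_im_pos.mem_nhds him))
    filter_upwards [nhdsWithin_mono s hS ha, self_mem_nhdsWithin,
      hy.continuousWithinAt.eventually (Metric.ball_mem_nhds _ hρ)] with r hr hrS hyr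
    have hd : ∀ x ∈ Metric.ball (y s) ρ, HasDerivWithinAt (fun x => M r x - D * x)
        (deriv (M r) x - D) (Metric.ball (y s) ρ) x := by
      intro x hx
      have hx2 : DifferentiableAt ℂ (M r) x :=
        (hM.differentiableOn r (hS hrS)).differentiableAt (isOpen_im_pos.mem_nhds (hball hx).2)
      exact (hx2.hasDerivAt.sub ((hasDerivAt_id x).const_mul D)).hasDerivWithinAt.congr_deriv
        (by rw [mul_one])
    have hle : ∀ x ∈ Metric.ball (y s) ρ, ‖deriv (M r) x - D‖ ≤ c := by
      intro x hx
      have := Metric.mem_ball.1 (hab hr (hball hx).1)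
      rw [dist_eq_norm] at this
      exact this.le
    have := (convex_ball (y s) ρ).norm_image_sub_le_of_norm_hasDerivWithin_le hd hle
      (Metric.mem_ball_self hρ) hyr
    refine le_trans (le_of_eq ?_) this
    congr 1
    ring
  have h4 := (h1.add h2).add h3
  rw [add_zero] at h4
  refine h4.congr (fun r _ => ?_) ?_
  · simp only [Pi.add_apply]; ring
  · simp only [Pi.add_apply]; ring

lemma hasDerivAt_charMap_time (ζ : ℂ) (s : ℝ) :
    HasDerivAt (fun s : ℝ => charMap μ s ζ) (2 * cauchyTransform μ ζ) s := by
  have h : HasDerivAt (fun s : ℝ => (s : ℂ)) 1 s := Complex.ofRealCLM.hasDerivAt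
  refine (((h.const_mul 2).mul_const (cauchyTransform μ ζ)).const_add ζ).congr_deriv ?_
  ring

variable [IsProbabilityMeasure μ] {R : ℝ}

lemma charDomain_antitone (hμ : ∀ᵐ u ∂μ, |u| ≤ R) {s t : ℝ} (hst : s ≤ t) :
    charDomain μ t ⊆ charDomain μ s := by
  rintro ζ ⟨h0, h1⟩
  refine ⟨h0, lt_of_le_of_lt ?_ h1⟩
  have := invSqDist_pos hμ (mem_exteriorRegion_of_im_pos (R := R) h0)
  gcongr

lemma charMap_im_pos (hμ : ∀ᵐ u ∂μ, |u| ≤ R) {t : ℝ} {ζ : ℂ} (hζ : ζ ∈ charDomain μ t) :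
    0 < (charMap μ t ζ).im := by
  rw [im_charMap hμ t (mem_exteriorRegion_of_im_pos hζ.1)]
  exact mul_pos hζ.1 (sub_pos.2 hζ.2)

/-- A solution is constant along characteristics: the difference from its initial value satisfies a
homogeneous linear differential equation along the straight line `charMap μ · ζ`. -/
lemma IsBurgersSolution.apply_charMap (hM : IsBurgersSolution μ M) (hμ : ∀ᵐ u ∂μ, |u| ≤ R)
    {t : ℝ} (ht : 0 ≤ t) {ζ : ℂ} (hζ : ζ ∈ charDomain μ t) :
    M t (charMap μ t ζ) = cauchyTransform μ ζ := by
  have him : ∀ s ∈ Icc 0 t, 0 < (charMap μ s ζ).im := fun s hs =>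
    charMap_im_pos hμ (charDomain_antitone hμ hs.2 hζ)
  have hd : ∀ s ∈ Icc 0 t, HasDerivWithinAt
      (fun s => M s (charMap μ s ζ) - cauchyTransform μ ζ)
      (-2 * deriv (M s) (charMap μ s ζ) * (M s (charMap μ s ζ) - cauchyTransform μ ζ))
      (Icc 0 t) s := by
    intro s hs
    refine ((hM.hasDerivWithinAt_comp Icc_subset_Ici_self hs
      (hasDerivAt_charMap_time ζ s).hasDerivWithinAt (him s hs)).sub_const _).congr_deriv ?_
    ring
  have hmaps : MapsTo (fun s : ℝ => (s, charMap μ s ζ)) (Icc 0 t)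
      (Ici (0 : ℝ) ×ˢ {z : ℂ | 0 < z.im}) := fun s hs => ⟨hs.1, him s hs⟩
  have hcc : Continuous (fun s : ℝ => charMap μ s ζ) :=
    continuous_iff_continuousAt.2 fun s => (hasDerivAt_charMap_time ζ s).continuousAt
  have hcont : ContinuousOn (fun s => deriv (M s) (charMap μ s ζ)) (Icc 0 t) :=
    hM.continuousOn_deriv.comp (continuous_id.prodMk hcc).continuousOn hmaps
  obtain ⟨C, hC⟩ := isCompact_Icc.exists_bound_of_continuousOn hcont
  have hzero : M 0 (charMap μ 0 ζ) - cauchyTransform μ ζ = 0 := by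
    have : charMap μ 0 ζ = ζ := by simp [charMap]
    rw [this, hM.initial ζ hζ.1, cauchyTransform, sub_self]
  have := eq_zero_of_abs_deriv_le_mul_abs_self_of_eq_zero_right (K := 2 * C)
    (fun s hs => (hd s hs).continuousWithinAt)
    (fun s hs => (hd s (Ico_subset_Icc_self hs)).mono_of_mem_nhdsWithin
      (Icc_mem_nhdsGE_of_mem hs)) hzero (fun s hs => by
        rw [norm_mul, norm_mul, norm_neg, Complex.norm_ofNat]
        have := hC s (Ico_subset_Icc_self hs)
        gcongr) t ⟨ht, le_rfl⟩
  exact sub_eq_zero.1 this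

lemma norm_two_mul_cauchyTransform_le (hμ : ∀ᵐ u ∂μ, |u| ≤ R) {t : ℝ} (ht : 0 ≤ t) {ζ : ℂ}
    (hζ : ζ ∈ exteriorRegion R) (hk : 4 * t * invSqDist μ ζ ≤ 1) :
    ‖2 * (t : ℂ) * cauchyTransform μ ζ‖ ≤ 4 * t + 1 := by
  have h1 := norm_cauchyTransform_sq_le hμ hζ
  rw [norm_mul, norm_mul, Complex.norm_ofNat, Complex.norm_real, Real.norm_of_nonneg ht]
  refine abs_le_of_sq_le_sq' ?_ (by positivity) |>.2
  have h2 : (2 * t * ‖cauchyTransform μ ζ‖) ^ 2 ≤ 4 * t := by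
    calc (2 * t * ‖cauchyTransform μ ζ‖) ^ 2 = 4 * t ^ 2 * ‖cauchyTransform μ ζ‖ ^ 2 := by ring
      _ ≤ 4 * t ^ 2 * (4 * invSqDist μ ζ) := by gcongr
      _ = 4 * t * (4 * t * invSqDist μ ζ) := by ring
      _ ≤ 4 * t * 1 := by gcongr
      _ = 4 * t := by ring
  nlinarith [sq_nonneg t]

lemma continuousAt_charMap (hμ : ∀ᵐ u ∂μ, |u| ≤ R) (t : ℝ) {ζ : ℂ} (hζ : ζ ∈ exteriorRegion R) :
    ContinuousAt (charMap μ t) ζ :=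
  continuousAt_id.add (continuousAt_const.mul (continuousAt_cauchyTransform hμ hζ))

lemma isOpen_charDomain (hμ : ∀ᵐ u ∂μ, |u| ≤ R) (t : ℝ) : IsOpen (charDomain μ t) := by
  rw [isOpen_iff_mem_nhds]
  rintro ζ ⟨h0, h1⟩
  refine Filter.inter_mem (isOpen_im_pos.mem_nhds h0) ?_
  exact (continuousAt_const.mul (continuousAt_invSqDist hμ
    (mem_exteriorRegion_of_im_pos (R := R) h0))).eventually_lt_const h1

lemma mem_charDomain_of_im (hμ : ∀ᵐ u ∂μ, |u| ≤ R) {t : ℝ} (ht : 0 ≤ t) {ζ : ℂ}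
    (h : 2 * t + 1 ≤ ζ.im) : ζ ∈ charDomain μ t := by
  have h0 : 0 < ζ.im := by linarith
  refine ⟨h0, ?_⟩
  have h1 := invSqDist_le hμ (mem_exteriorRegion_of_im_pos (R := R) h0) h0
    (fun u _ => im_le_norm_sub_ofReal ζ u)
  calc 4 * t * invSqDist μ ζ ≤ 4 * t * (1 / ζ.im ^ 2) := by gcongr
    _ < 1 := by
      rw [mul_one_div, div_lt_one (by positivity)]
      nlinarith

/-- The characteristics cover the upper half-plane: the image of `charDomain μ t` under
`charMap μ t` is open, and closed because the map moves points by a bounded amount and does not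
raise them. -/
lemma exists_charMap_eq (hμ : ∀ᵐ u ∂μ, |u| ≤ R) {t : ℝ} (ht : 0 ≤ t) {w : ℂ} (hw : 0 < w.im) :
    ∃ ζ ∈ charDomain μ t, charMap μ t ζ = w := by
  have hopen : IsOpen (charMap μ t '' charDomain μ t) := by
    rw [isOpen_iff_mem_nhds]
    rintro _ ⟨ζ, hζ, rfl⟩
    have h1 := (hasStrictDerivAt_of_im_pos (fun z hz => hasDerivAt_charMap hμ t hz) hζ.1).1
    rw [← h1.map_nhds_eq (charMapDeriv_ne_zero hμ ht hζ.1 hζ.2.le)]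
    exact image_mem_map ((isOpen_charDomain hμ t).mem_nhds hζ)
  have hconn : IsPreconnected {z : ℂ | 0 < z.im} :=
    (convex_halfSpace_im_gt 0).isPreconnected
  refine hconn.subset_of_closure_inter_subset hopen ?_ ?_ hw
  · have h1 : (Complex.I * ((2 * t + 1 : ℝ) : ℂ)) ∈ charDomain μ t :=
      mem_charDomain_of_im hμ ht (by simp)
    exact ⟨_, charMap_im_pos hμ h1, mem_image_of_mem _ h1⟩
  · rintro x ⟨hx, hx0⟩
    simp only [mem_ofPred_eq] at hx0
    obtain ⟨v, hv, hvx⟩ := mem_closure_iff_seq_limit.1 hx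
    choose ζ hζ hζv using hv
    obtain ⟨B, hB⟩ := (Metric.isBounded_range_of_tendsto v hvx).exists_norm_le
    have hbd : ∀ n, ζ n ∈ Metric.closedBall (0 : ℂ) (B + (4 * t + 1)) := by
      intro n
      rw [mem_closedBall_zero_iff]
      have h1 : ζ n = v n - 2 * t * cauchyTransform μ (ζ n) := by
        rw [← hζv n, charMap]; ring
      rw [h1]
      exact (norm_sub_le _ _).trans (add_le_add (hB _ (mem_range_self n))
        (norm_two_mul_cauchyTransform_le hμ ht (mem_exteriorRegion_of_im_pos (hζ n).1)
          (hζ n).2.le))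
    obtain ⟨a, -, φ, hφ, ha⟩ := tendsto_subseq_of_bounded Metric.isBounded_closedBall hbd
    have hvφ : Tendsto (v ∘ φ) atTop (𝓝 x) := hvx.comp hφ.tendsto_atTop
    have him : x.im ≤ a.im := by
      refine le_of_tendsto_of_tendsto' ((Complex.continuous_im.tendsto x).comp hvφ)
        ((Complex.continuous_im.tendsto a).comp ha) fun n => ?_
      simp only [Function.comp]
      rw [← hζv, im_charMap hμ t (mem_exteriorRegion_of_im_pos (hζ _).1)]
      have h2 := invSqDist_pos hμ (mem_exteriorRegion_of_im_pos (R := R) (hζ (φ n)).1)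
      nlinarith [(hζ (φ n)).1, mul_nonneg (hζ (φ n)).1.le (mul_nonneg ht h2.le)]
    have ha0 : 0 < a.im := hx0.trans_le him
    have ha' : a ∈ exteriorRegion R := Or.inl ha0
    have hlim : Tendsto (v ∘ φ) atTop (𝓝 (charMap μ t a)) := by
      refine ((continuousAt_charMap hμ t ha').tendsto.comp ha).congr fun n => ?_
      exact hζv _
    have heq : charMap μ t a = x := tendsto_nhds_unique hlim hvφ
    refine ⟨a, ⟨ha0, ?_⟩, heq⟩
    have h3 := im_charMap hμ t ha'
    rw [heq] at h3
    rw [h3] at hx0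
    linarith [(pos_iff_pos_of_mul_pos hx0).1 ha0]

/-- The value of a solution at `w`, in terms of the starting point of the characteristic
through `w`. -/
lemma IsBurgersSolution.exists_foot (hM : IsBurgersSolution μ M) (hμ : ∀ᵐ u ∂μ, |u| ≤ R)
    {t : ℝ} (ht : 0 ≤ t) {w : ℂ} (hw : 0 < w.im) :
    w - 2 * t * M t w ∈ charDomain μ t ∧ charMap μ t (w - 2 * t * M t w) = w ∧
      M t w = cauchyTransform μ (w - 2 * t * M t w) := by
  obtain ⟨ζ, hζ, rfl⟩ := exists_charMap_eq hμ ht hw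
  rw [hM.apply_charMap hμ ht hζ]
  have : charMap μ t ζ - 2 * t * cauchyTransform μ ζ = ζ := by rw [charMap]; ring
  rw [this]
  exact ⟨hζ, rfl, rfl⟩

lemma IsBurgersSolution.im_neg (hM : IsBurgersSolution μ M) (hμ : ∀ᵐ u ∂μ, |u| ≤ R)
    {t : ℝ} (ht : 0 ≤ t) {w : ℂ} (hw : 0 < w.im) : (M t w).im < 0 := by
  obtain ⟨h1, -, h3⟩ := hM.exists_foot hμ ht hw
  rw [h3]
  exact im_cauchyTransform_neg hμ h1.1

lemma IsBurgersSolution.norm_le (hM : IsBurgersSolution μ M) (hμ : ∀ᵐ u ∂μ, |u| ≤ R)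
    {t : ℝ} (ht : 0 ≤ t) {w : ℂ} (hw : 0 < w.im) : ‖M t w‖ ≤ 2 / w.im := by
  obtain ⟨h1, -, h3⟩ := hM.exists_foot hμ ht hw
  have h4 := hM.im_neg hμ ht hw
  have h5 : w.im ≤ (w - 2 * t * M t w).im := by
    have : (2 * (t : ℂ)) = ((2 * t : ℝ) : ℂ) := by push_cast; rfl
    rw [this, Complex.sub_im, Complex.im_ofReal_mul]
    nlinarith
  have hζ := mem_exteriorRegion_of_im_pos (R := R) h1.1
  have h6 := norm_cauchyTransform_sq_le hμ hζ
  have h7 := invSqDist_le hμ hζ h1.1 (fun u _ => im_le_norm_sub_ofReal _ u)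
  rw [← h3] at h6
  refine (abs_le_of_sq_le_sq' ?_ (by positivity)).2
  calc ‖M t w‖ ^ 2 ≤ 4 * (1 / (w - 2 * t * M t w).im ^ 2) := h6.trans (by gcongr)
    _ ≤ 4 * (1 / w.im ^ 2) := by gcongr
    _ = (2 / w.im) ^ 2 := by ring

/-- Cauchy's estimate for the derivative. -/
lemma IsBurgersSolution.lipschitzOnWith (hM : IsBurgersSolution μ M) (hμ : ∀ᵐ u ∂μ, |u| ≤ R)
    {t : ℝ} (ht : 0 ≤ t) {ε : ℝ} (hε : 0 < ε) :
    LipschitzOnWith (Real.toNNReal (8 / ε ^ 2)) (M t) {w : ℂ | ε ≤ w.im} := by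
  refine (convex_halfSpace_im_ge ε).lipschitzOnWith_of_nnnorm_deriv_le (fun w hw => ?_)
    (fun w hw => ?_)
  · exact (hM.differentiableOn t ht).differentiableAt (isOpen_im_pos.mem_nhds (hε.trans_le hw))
  · simp only [mem_ofPred_eq] at hw
    have hsub : ∀ z ∈ Metric.closedBall w (ε / 2), ε / 2 ≤ z.im := by
      intro z hz
      rw [mem_closedBall_iff_norm] at hz
      have := (Complex.abs_im_le_norm (z - w)).trans hz
      rw [Complex.sub_im, abs_le] at this
      linarith
    have h := Complex.norm_deriv_le_of_forall_mem_sphere_norm_le (half_pos hε)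
      ((hM.differentiableOn t ht).diffContOnCl_ball (c := w) (R := ε / 2)
        fun z hz => (half_pos hε).trans_le (hsub z hz))
      (C := 2 / (ε / 2)) (fun z hz => by
        have h1 := hsub z (Metric.sphere_subset_closedBall hz)
        refine (hM.norm_le hμ ht (by linarith)).trans ?_
        gcongr)
    rw [← NNReal.coe_le_coe, coe_nnnorm, Real.coe_toNNReal _ (by positivity)]
    refine h.trans (le_of_eq ?_)
    field_simp
    norm_num

/-! ### Loewner trajectories -/

/-- Two Loewner trajectories with the same starting point agree. -/
lemma IsLoewnerTrajectory.unique (hM : IsBurgersSolution μ M) (hμ : ∀ᵐ u ∂μ, |u| ≤ R) {t : ℝ}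
    (ht : 0 ≤ t) {z : ℂ} {y₁ y₂ : ℝ → ℂ} (h₁ : IsLoewnerTrajectory M t z y₁)
    (h₂ : IsLoewnerTrajectory M t z y₂) : y₁ t = y₂ t := by
  have hc : ∀ y, IsLoewnerTrajectory M t z y → ContinuousOn y (Icc 0 t) :=
    fun y hy s hs => (hy.2 s hs).2.continuousWithinAt
  have hmin : ∀ y, IsLoewnerTrajectory M t z y → ∃ ε > 0, ∀ s ∈ Icc 0 t, ε ≤ (y s).im := by
    intro y hy
    obtain ⟨s, hs, hmin⟩ := isCompact_Icc.exists_isMinOn (nonempty_Icc.2 ht)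
      (Complex.continuous_im.comp_continuousOn (hc y hy))
    exact ⟨(y s).im, (hy.2 s hs).1, fun r hr => hmin hr⟩
  obtain ⟨ε₁, hε₁, hy₁⟩ := hmin y₁ h₁
  obtain ⟨ε₂, hε₂, hy₂⟩ := hmin y₂ h₂
  refine ODE_solution_unique_of_mem_Icc_right (v := M) (s := fun _ => {w | min ε₁ ε₂ ≤ w.im})
    (fun s hs => hM.lipschitzOnWith hμ hs.1 (lt_min hε₁ hε₂)) (hc _ h₁)
    (fun s hs => (h₁.2 s (Ico_subset_Icc_self hs)).2.mono_of_mem_nhdsWithin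
      (Icc_mem_nhdsGE_of_mem hs))
    (fun s hs => (min_le_left _ _).trans (hy₁ s (Ico_subset_Icc_self hs))) (hc _ h₂)
    (fun s hs => (h₂.2 s (Ico_subset_Icc_self hs)).2.mono_of_mem_nhdsWithin
      (Icc_mem_nhdsGE_of_mem hs))
    (fun s hs => (min_le_right _ _).trans (hy₂ s (Ico_subset_Icc_self hs))) (h₁.1.trans h₂.1.symm)
    ⟨ht, le_rfl⟩

/-- The vertical projection of the plane onto the half-plane `{ε ≤ im}`. -/
def raiseIm (ε : ℝ) (z : ℂ) : ℂ := ⟨z.re, max z.im ε⟩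

lemma lipschitzWith_raiseIm (ε : ℝ) : LipschitzWith 2 (raiseIm ε) := by
  refine LipschitzWith.of_dist_le_mul fun a b => ?_
  rw [dist_eq_norm, dist_eq_norm]
  refine (Complex.norm_le_abs_re_add_abs_im _).trans ?_
  have h1 := Complex.abs_re_le_norm (a - b)
  have h2 := Complex.abs_im_le_norm (a - b)
  have h3 := abs_max_sub_max_le_abs a.im b.im ε
  simp only [raiseIm, Complex.sub_re, Complex.sub_im, NNReal.coe_ofNat] at *
  linarith

/-- Every point of the upper half-plane is the endpoint of a Loewner trajectory. The backward flow
moves points up, so the vector field can be cut off below the height of the endpoint, which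
makes it bounded and globally Lipschitz. -/
lemma IsBurgersSolution.exists_trajectory (hM : IsBurgersSolution μ M) (hμ : ∀ᵐ u ∂μ, |u| ≤ R)
    {t : ℝ} (ht : 0 ≤ t) {w : ℂ} (hw : 0 < w.im) :
    ∃ z y, IsLoewnerTrajectory M t z y ∧ y t = w := by
  set ε := w.im
  have hraise : ∀ x, ε ≤ (raiseIm ε x).im := fun x => le_max_right _ _
  have hPL : IsPicardLindelof (fun s x => M s (raiseIm ε x)) (⟨t, ht, le_rfl⟩ : Icc 0 t) w
      (Real.toNNReal (2 / ε) * Real.toNNReal t) 0 (Real.toNNReal (2 / ε))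
      (Real.toNNReal (8 / ε ^ 2) * 2) := by
    refine ⟨fun s hs => ?_, fun x _ => ?_, fun s hs x _ => ?_, ?_⟩
    · exact (hM.lipschitzOnWith hμ hs.1 hw).comp (lipschitzWith_raiseIm ε).lipschitzOnWith
        fun x _ => hraise x
    · exact hM.continuousOn.comp (continuous_id.prodMk continuous_const).continuousOn
        fun s hs => ⟨hs.1, hw.trans_le (hraise x)⟩
    · rw [Real.coe_toNNReal _ (by positivity)]
      refine (hM.norm_le hμ hs.1 (hw.trans_le (hraise x))).trans ?_
      have := hraise x
      gcongr
    · simp [ht]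
  obtain ⟨y, hy, hyd⟩ := hPL.exists_eq_forall_mem_Icc_hasDerivWithinAt
    (Metric.mem_closedBall_self (by simp))
  simp only at hy
  have hanti : AntitoneOn (fun s => (y s).im) (Icc 0 t) := by
    refine antitoneOn_of_hasDerivWithinAt_nonpos (convex_Icc 0 t)
      (Complex.continuous_im.comp_continuousOn fun s hs => (hyd s hs).continuousWithinAt)
      (f' := fun s => (M s (raiseIm ε (y s))).im) (fun s hs => ?_) fun s hs => ?_
    · exact Complex.imCLM.hasFDerivAt.comp_hasDerivWithinAt s
        ((hyd s (interior_subset hs)).mono interior_subset)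
    · exact (hM.im_neg hμ (interior_subset hs : s ∈ Icc 0 t).1 (hw.trans_le (hraise _))).le
  have hge : ∀ s ∈ Icc 0 t, ε ≤ (y s).im := by
    intro s hs
    have := hanti hs ⟨ht, le_rfl⟩ hs.2
    simp only [hy] at this
    exact this
  refine ⟨y 0, y, ⟨rfl, fun s hs => ⟨hw.trans_le (hge s hs), ?_⟩⟩, hy⟩
  have h1 : raiseIm ε (y s) = y s := Complex.ext rfl (max_eq_left (hge s hs))
  have h2 := hyd s hs
  rwa [h1] at h2

/-- The conservation law: `potentialMap μ s` at the foot of the characteristic through the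
trajectory at time `s` does not depend on `s`. -/
lemma IsLoewnerTrajectory.potentialMap_eq (hM : IsBurgersSolution μ M) (hμ : ∀ᵐ u ∂μ, |u| ≤ R)
    {t : ℝ} (ht : 0 ≤ t) {z : ℂ} {y : ℝ → ℂ} (hy : IsLoewnerTrajectory M t z y) :
    potentialMap μ t (y t - 2 * t * M t (y t)) = logPotential μ z := by
  have hd : ∀ s ∈ Icc 0 t, HasDerivWithinAt
      (fun s => logPotential μ (y s - 2 * s * M s (y s)) + s * M s (y s) ^ 2) 0 (Icc 0 t) s := by
    intro s hs
    obtain ⟨him, hys⟩ := hy.2 s hs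
    obtain ⟨h1, -, h3⟩ := hM.exists_foot hμ hs.1 him
    have hMy := hM.hasDerivWithinAt_comp Icc_subset_Ici_self hs hys him
    have hs1 : HasDerivWithinAt (fun s : ℝ => (s : ℂ)) 1 (Icc 0 t) s :=
      Complex.ofRealCLM.hasDerivAt.hasDerivWithinAt
    have hfoot := hys.sub ((hs1.const_mul 2).mul hMy)
    have hF := (hasDerivAt_logPotential hμ h1.1).comp_hasDerivWithinAt s hfoot
    refine (hF.add (hs1.mul (hMy.pow 2))).congr_deriv ?_
    rw [← h3]
    simp only [Pi.pow_apply]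
    push_cast
    ring
  have hconst := constant_of_has_deriv_right_zero
    (fun s hs => (hd s hs).continuousWithinAt) (fun s hs =>
      (hd s (Ico_subset_Icc_self hs)).mono_of_mem_nhdsWithin (Icc_mem_nhdsGE_of_mem hs))
    t ⟨ht, le_rfl⟩
  obtain ⟨-, -, h3⟩ := hM.exists_foot hμ ht (hy.2 t ⟨ht, le_rfl⟩).1
  rw [potentialMap, ← h3, hconst, hy.1]
  simp

/-- Every point of `charDomain μ t` is the foot of the characteristic through the endpoint of a
Loewner trajectory. -/
lemma IsBurgersSolution.exists_trajectory_of_mem_charDomain (hM : IsBurgersSolution μ M)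
    (hμ : ∀ᵐ u ∂μ, |u| ≤ R) {t : ℝ} (ht : 0 ≤ t) {ζ : ℂ} (hζ : ζ ∈ charDomain μ t) :
    ∃ z y, 0 < z.im ∧ IsLoewnerTrajectory M t z y ∧ y t = charMap μ t ζ ∧
      potentialMap μ t ζ = logPotential μ z := by
  obtain ⟨z, y, hy, hyt⟩ := hM.exists_trajectory hμ ht (charMap_im_pos hμ hζ)
  have h1 := hy.potentialMap_eq hM hμ ht
  have h2 : charMap μ t ζ - 2 * t * cauchyTransform μ ζ = ζ := by rw [charMap]; ring
  rw [hyt, hM.apply_charMap hμ ht hζ, h2] at h1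
  have h3 : 0 < z.im := by
    have := (hy.2 0 ⟨le_rfl, ht⟩).1
    rwa [hy.1] at this
  exact ⟨z, y, h3, hy, hyt, h1⟩

/-- The domain of the Loewner map in terms of the initial measure alone. -/
lemma IsBurgersSolution.mem_loewnerDomain_iff (hM : IsBurgersSolution μ M)
    (hμ : ∀ᵐ u ∂μ, |u| ≤ R) {t : ℝ} (ht : 0 ≤ t) {z : ℂ} :
    z ∈ loewnerDomain M t ↔
      0 < z.im ∧ ∃ ζ ∈ charDomain μ t, potentialMap μ t ζ = logPotential μ z := by
  constructor
  · rintro ⟨hz, y, hy⟩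
    exact ⟨hz, _, (hM.exists_foot hμ ht (hy.2 t ⟨ht, le_rfl⟩).1).1, hy.potentialMap_eq hM hμ ht⟩
  · rintro ⟨hz, ζ, hζ, h⟩
    obtain ⟨z', y, hz', hy, -, he⟩ := hM.exists_trajectory_of_mem_charDomain hμ ht hζ
    rw [logPotential_injOn hμ hz hz' (h.symm.trans he)]
    exact ⟨hz', y, hy⟩

lemma IsBurgersSolution.potentialMap_injOn (hM : IsBurgersSolution μ M)
    (hμ : ∀ᵐ u ∂μ, |u| ≤ R) {t : ℝ} (ht : 0 ≤ t) : InjOn (potentialMap μ t) (charDomain μ t) := by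
  intro ζ hζ ζ' hζ' h
  obtain ⟨z, y, hz, hy, hyt, he⟩ := hM.exists_trajectory_of_mem_charDomain hμ ht hζ
  obtain ⟨z', y', hz', hy', hyt', he'⟩ := hM.exists_trajectory_of_mem_charDomain hμ ht hζ'
  have hzz : z = z' := logPotential_injOn hμ hz hz' (by rw [← he, ← he', h])
  subst hzz
  have h1 := hy.unique hM hμ ht hy'
  rw [hyt, hyt'] at h1
  exact charMap_injOn hμ ht ⟨hζ.1, hζ.2.le⟩ ⟨hζ'.1, hζ'.2.le⟩ h1

end Characteristics

/-! ### Bounded open sets of reals with at most two boundary points -/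

lemma exists_right_frontier_point {I : Set ℝ} (hI : IsOpen I) (hb : BddAbove I) {x : ℝ}
    (hx : x ∈ I) : ∃ b ∈ frontier I, x < b ∧ Ico x b ⊆ I := by
  have hcl : IsClosed (Iᶜ ∩ Ici x) := hI.isClosed_compl.inter isClosed_Ici
  have hne : (Iᶜ ∩ Ici x).Nonempty := by
    obtain ⟨B, hB⟩ := hb
    refine ⟨max B x + 1, fun h => ?_, ?_⟩
    · have := hB h
      linarith [le_max_left B x]
    · simp only [mem_Ici]
      linarith [le_max_right B x]
  have hbd : BddBelow (Iᶜ ∩ Ici x) := ⟨x, fun y hy => hy.2⟩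
  have hmem := hcl.csInf_mem hne hbd
  set b := sInf (Iᶜ ∩ Ici x)
  have hxb : x < b := lt_of_le_of_ne hmem.2 fun h => hmem.1 (h ▸ hx)
  have hsub : Ico x b ⊆ I := by
    intro y hy
    by_contra hyI
    exact absurd (csInf_le hbd ⟨hyI, hy.1⟩) (not_le.2 hy.2)
  refine ⟨b, ?_, hxb, hsub⟩
  rw [hI.frontier_eq]
  refine ⟨closure_mono hsub ?_, hmem.1⟩
  rw [closure_Ico hxb.ne]
  exact ⟨hxb.le, le_rfl⟩

lemma exists_left_frontier_point {I : Set ℝ} (hI : IsOpen I) (hb : BddBelow I) {x : ℝ}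
    (hx : x ∈ I) : ∃ a ∈ frontier I, a < x ∧ Ioc a x ⊆ I := by
  have hcl : IsClosed (Iᶜ ∩ Iic x) := hI.isClosed_compl.inter isClosed_Iic
  have hne : (Iᶜ ∩ Iic x).Nonempty := by
    obtain ⟨B, hB⟩ := hb
    refine ⟨min B x - 1, fun h => ?_, ?_⟩
    · have := hB h
      linarith [min_le_left B x]
    · simp only [mem_Iic]
      linarith [min_le_right B x]
  have hbd : BddAbove (Iᶜ ∩ Iic x) := ⟨x, fun y hy => hy.2⟩
  have hmem := hcl.csSup_mem hne hbd
  set a := sSup (Iᶜ ∩ Iic x)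
  have hxa : a < x := lt_of_le_of_ne hmem.2 fun h => hmem.1 (h ▸ hx)
  have hsub : Ioc a x ⊆ I := by
    intro y hy
    by_contra hyI
    exact absurd (le_csSup hbd ⟨hyI, hy.2⟩) (not_le.2 hy.1)
  refine ⟨a, ?_, hxa, hsub⟩
  rw [hI.frontier_eq]
  refine ⟨closure_mono hsub ?_, hmem.1⟩
  rw [closure_Ioc hxa.ne]
  exact ⟨le_rfl, hxa.le⟩

/-- A nonempty bounded open set of reals with at most two boundary points is an interval. -/
lemma exists_eq_Ioo_of_frontier_subset {I P Q : Set ℝ} (hI : IsOpen I) (hne : I.Nonempty)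
    (ha : BddAbove I) (hb : BddBelow I) (hPQ : frontier I ⊆ P ∪ Q) (hP : P.Subsingleton)
    (hQ : Q.Subsingleton) : ∃ a b, a < b ∧ I = Ioo a b := by
  have key : ∀ x ∈ I, ∃ a ∈ frontier I, ∃ b ∈ frontier I, a < x ∧ x < b ∧ Ioo a b ⊆ I := by
    intro x hx
    obtain ⟨b, hbf, hxb, h1⟩ := exists_right_frontier_point hI ha hx
    obtain ⟨a, haf, hxa, h2⟩ := exists_left_frontier_point hI hb hx
    refine ⟨a, haf, b, hbf, hxa, hxb, fun y hy => ?_⟩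
    rcases le_total y x with h | h
    · exact h2 ⟨hy.1, h⟩
    · exact h1 ⟨h, hy.2⟩
  obtain ⟨x, hx⟩ := hne
  obtain ⟨a, haf, b, hbf, hax, hxb, hsub⟩ := key x hx
  refine ⟨a, b, hax.trans hxb, Subset.antisymm (fun y hy => ?_) hsub⟩
  obtain ⟨a', haf', b', hbf', hay, hyb, -⟩ := key y hy
  have hab := hax.trans hxb
  have hab' := hay.trans hyb
  rcases hPQ haf with h1 | h1 <;> rcases hPQ hbf with h2 | h2 <;>
  rcases hPQ haf' with h3 | h3 <;> rcases hPQ hbf' with h4 | h4 <;>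
  first
  | exact absurd (hP h1 h2) hab.ne
  | exact absurd (hQ h1 h2) hab.ne
  | exact absurd (hP h3 h4) hab'.ne
  | exact absurd (hQ h3 h4) hab'.ne
  | (have e1 := hP h1 h3; have e2 := hQ h2 h4; subst e1; subst e2; exact ⟨hay, hyb⟩)
  | (have e1 := hQ h1 h3; have e2 := hP h2 h4; subst e1; subst e2; exact ⟨hay, hyb⟩)
  | (have e1 := hP h1 h4; have e2 := hQ h2 h3; linarith)
  | (have e1 := hQ h1 h4; have e2 := hP h2 h3; linarith)

/-! ### Points of the real line hit by characteristics -/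

/-- The parameter interval: the points of the real line hit at time `t` by a characteristic which
starts in the upper half-plane and stays there before time `t`. -/
def hitSet (μ : Measure ℝ) (t : ℝ) : Set ℝ := {x | (x : ℂ) ∈ charMap μ t '' charCurve μ t}

/-- The starting point on `charCurve μ t` of the characteristic which hits the real line at `x`. -/
def hitFoot (μ : Measure ℝ) (t : ℝ) (x : ℝ) : ℂ :=
  Function.invFunOn (charMap μ t) (charCurve μ t) x

lemma hitFoot_mem {μ : Measure ℝ} {t x : ℝ} (hx : x ∈ hitSet μ t) : hitFoot μ t x ∈ charCurve μ t :=
  Function.invFunOn_mem hx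

lemma charMap_hitFoot {μ : Measure ℝ} {t x : ℝ} (hx : x ∈ hitSet μ t) :
    charMap μ t (hitFoot μ t x) = x :=
  Function.invFunOn_eq hx

section Hull

variable {μ : Measure ℝ} [IsProbabilityMeasure μ] {R : ℝ}

/-! ### Behaviour of the potential near the real line and near infinity -/

lemma lt_one_of_norm_ge (hμ : ∀ᵐ u ∂μ, |u| ≤ R) {t : ℝ} (ht : 0 ≤ t) {ζ : ℂ}
    (h : R + 2 * t + 1 ≤ ‖ζ‖) : 4 * t * invSqDist μ ζ < 1 := by
  have h1 := invSqDist_le hμ (z := ζ) (Or.inr (by linarith)) (show 0 < 2 * t + 1 by positivity)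
    (fun u hu => by linarith [norm_sub_le_norm_sub_ofReal ζ hu])
  calc 4 * t * invSqDist μ ζ ≤ 4 * t * (1 / (2 * t + 1) ^ 2) := by gcongr
    _ < 1 := by
      rw [mul_one_div, div_lt_one (by positivity)]
      nlinarith

lemma four_mul_le_sq (hμ : ∀ᵐ u ∂μ, |u| ≤ R) (hR : 0 ≤ R) {t : ℝ} (ht : 0 ≤ t) {ζ : ℂ}
    (hζ : ζ ∈ exteriorRegion R) (h : 4 * t * invSqDist μ ζ ≤ 1) : 4 * t ≤ (‖ζ‖ + R) ^ 2 := by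
  have h1 := le_invSqDist hμ hζ (fun u hu => norm_sub_ofReal_le ζ hu)
  have h0 : 0 < ‖ζ‖ + R := by
    have := norm_pos_iff.2 (sub_ne_zero_of_mem_exteriorRegion hζ (u := 0) (by simpa using hR))
    simp at this
    positivity
  have h2 : 4 * t * (1 / (‖ζ‖ + R) ^ 2) ≤ 1 := le_trans (by gcongr) h
  rwa [mul_one_div, div_le_one (by positivity)] at h2

/-- Beyond the time `9 R ^ 2`, the closure of `charDomain μ t` is so far from `[-R, R]` that all
points of modulus comparable, in the sense of `norm_le_of_re_eq`, are outside this segment too. -/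
lemma five_mul_lt_norm (hR : 0 ≤ R) {t : ℝ} (htR : 9 * R ^ 2 < t) {ζ : ℂ}
    (h : 4 * t ≤ (‖ζ‖ + R) ^ 2) : 5 * R < ‖ζ‖ := by
  have : 6 * R < ‖ζ‖ + R := lt_of_pow_lt_pow_left₀ 2 (by positivity) (by nlinarith)
  linarith

lemma continuousWithinAt_potentialMap (hμ : ∀ᵐ u ∂μ, |u| ≤ R) (t : ℝ) {z : ℂ}
    (hz : z ∈ exteriorRegion R) (hz0 : 0 ≤ z.im) :
    ContinuousWithinAt (potentialMap μ t) {z | 0 ≤ z.im} z :=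
  (continuousWithinAt_logPotential hμ hz hz0).add (continuousWithinAt_const.mul
    ((continuousAt_cauchyTransform hμ hz).continuousWithinAt.pow 2))

lemma potentialMap_map_nhds (hμ : ∀ᵐ u ∂μ, |u| ≤ R) {t : ℝ} (ht : 0 ≤ t) {ζ : ℂ}
    (hζ : ζ ∈ charDomain μ t) :
    Filter.map (potentialMap μ t) (𝓝 ζ) = 𝓝 (potentialMap μ t ζ) :=
  (hasStrictDerivAt_of_im_pos (fun _ hz => hasDerivAt_potentialMap hμ t hz) hζ.1).1.map_nhds_eq
    (mul_ne_zero (cauchyTransform_ne_zero hμ hζ.1) (charMapDeriv_ne_zero hμ ht hζ.1 hζ.2.le))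

lemma logPotential_map_nhds (hμ : ∀ᵐ u ∂μ, |u| ≤ R) {z : ℂ} (hz : 0 < z.im) :
    Filter.map (logPotential μ) (𝓝 z) = 𝓝 (logPotential μ z) :=
  (hasStrictDerivAt_of_im_pos (fun _ hz => hasDerivAt_logPotential hμ hz) hz).1.map_nhds_eq
    (cauchyTransform_ne_zero hμ hz)

/-- Vertical translation upwards moves a point of `charCurve μ t` into `charDomain μ t`. -/
lemma charCurve_neBot (hμ : ∀ᵐ u ∂μ, |u| ≤ R) {t : ℝ} (ht : 0 < t) {ζ : ℂ}
    (hζ : ζ ∈ charCurve μ t) : (𝓝[charDomain μ t] ζ).NeBot := by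
  have hlim : Tendsto (fun ε : ℝ => ζ + ε * Complex.I) (𝓝[>] 0) (𝓝 ζ) := by
    have : ContinuousAt (fun ε : ℝ => ζ + ε * Complex.I) 0 := by fun_prop
    have h := this.tendsto
    simp only [Complex.ofReal_zero, zero_mul, add_zero] at h
    exact h.mono_left nhdsWithin_le_nhds
  have hmem : ∀ᶠ ε : ℝ in 𝓝[>] 0, ζ + ε * Complex.I ∈ charDomain μ t := by
    filter_upwards [self_mem_nhdsWithin] with ε hε
    simp only [mem_Ioi] at hε
    have him : (ζ + ε * Complex.I).im = ζ.im + ε := by simp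
    have h0 : 0 < (ζ + ε * Complex.I).im := by rw [him]; linarith [hζ.1]
    refine ⟨h0, ?_⟩
    rw [← hζ.2]
    refine mul_lt_mul_of_pos_left (invSqDist_lt hμ (mem_exteriorRegion_of_im_pos hζ.1)
      (mem_exteriorRegion_of_im_pos h0) fun u _ => ?_) (by positivity)
    refine lt_of_pow_lt_pow_left₀ 2 (norm_nonneg _) ?_
    rw [← Complex.normSq_eq_norm_sq, ← Complex.normSq_eq_norm_sq, Complex.normSq_apply,
      Complex.normSq_apply]
    simp
    nlinarith [hζ.1]
  exact (tendsto_nhdsWithin_iff.2 ⟨hlim, hmem⟩).neBot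

/-! ### The hull is bounded -/

variable {M : ℝ → ℂ → ℂ}

lemma IsBurgersSolution.isOpen_loewnerDomain (hM : IsBurgersSolution μ M)
    (hμ : ∀ᵐ u ∂μ, |u| ≤ R) {t : ℝ} (ht : 0 ≤ t) : IsOpen (loewnerDomain M t) := by
  rw [isOpen_iff_mem_nhds]
  intro z hz
  obtain ⟨hz0, ζ, hζ, h⟩ := (hM.mem_loewnerDomain_iff hμ ht).1 hz
  have h1 : potentialMap μ t '' charDomain μ t ∈ 𝓝 (logPotential μ z) := by
    rw [← h, ← potentialMap_map_nhds hμ ht hζ]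
    exact image_mem_map ((isOpen_charDomain hμ t).mem_nhds hζ)
  filter_upwards [(hasDerivAt_logPotential hμ hz0).continuousAt h1,
    isOpen_im_pos.mem_nhds hz0] with y hy hy0
  exact (hM.mem_loewnerDomain_iff hμ ht).2 ⟨hy0, hy⟩

/-- Every limit point in the upper half-plane of the domain of the Loewner map comes from a point in
the closure of `charDomain μ t`. That point is not real because the potential has imaginary part
`0` or `2 π` on the real line, and values strictly in between in the upper half-plane. -/
lemma IsBurgersSolution.exists_of_mem_closure (hM : IsBurgersSolution μ M)
    (hμ : ∀ᵐ u ∂μ, |u| ≤ R) (hR : 0 ≤ R) {t : ℝ} (ht : 0 ≤ t) {z : ℂ} (hz : 0 < z.im)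
    (hcl : z ∈ closure (loewnerDomain M t)) (hbig : 5 * R < ‖z‖ ∨ 9 * R ^ 2 < t) :
    ∃ ζ : ℂ, 0 < ζ.im ∧ 4 * t * invSqDist μ ζ ≤ 1 ∧
      potentialMap μ t ζ = logPotential μ z := by
  obtain ⟨v, hv, hvz⟩ := mem_closure_iff_seq_limit.1 hcl
  have hv' := fun n => (hM.mem_loewnerDomain_iff hμ ht).1 (hv n)
  choose hv0 ζ hζ hζv using hv'
  have hcomp := fun n => norm_le_of_re_eq hμ hR ht (mem_exteriorRegion_of_im_pos (hv0 n))
    (mem_exteriorRegion_of_im_pos (hζ n).1) (hζ n).2.le (congrArg Complex.re (hζv n).symm)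
  obtain ⟨B, hB⟩ := (Metric.isBounded_range_of_tendsto v hvz).exists_norm_le
  have hbd : ∀ n, ζ n ∈ Metric.closedBall (0 : ℂ) (2 * (B + R) + R) := by
    intro n
    rw [mem_closedBall_zero_iff]
    have := hB _ (mem_range_self n)
    linarith [(hcomp n).2]
  obtain ⟨a, -, φ, hφ, ha⟩ := tendsto_subseq_of_bounded Metric.isBounded_closedBall hbd
  have hvφ : Tendsto (v ∘ φ) atTop (𝓝 z) := hvz.comp hφ.tendsto_atTop
  have hanorm := (continuous_norm.tendsto a).comp ha
  have haR : R < ‖a‖ := by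
    rcases hbig with h | h
    · have h1 : ‖z‖ ≤ 2 * (‖a‖ + R) + R :=
        le_of_tendsto_of_tendsto' ((continuous_norm.tendsto z).comp hvφ)
          (((hanorm.add_const R).const_mul 2).add_const R) fun n => (hcomp (φ n)).1
      linarith
    · have h1 : 4 * t ≤ (‖a‖ + R) ^ 2 :=
        ge_of_tendsto' ((hanorm.add_const R).pow 2) fun n =>
          four_mul_le_sq hμ hR ht (mem_exteriorRegion_of_im_pos (hζ (φ n)).1) (hζ (φ n)).2.le
      linarith [five_mul_lt_norm hR h h1]
  have hae : a ∈ exteriorRegion R := Or.inr haR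
  have ha0 : 0 ≤ a.im := ge_of_tendsto' ((Complex.continuous_im.tendsto a).comp ha)
    fun n => (hζ (φ n)).1.le
  have hk : 4 * t * invSqDist μ a ≤ 1 :=
    le_of_tendsto' (((continuousAt_invSqDist hμ hae).tendsto.comp ha).const_mul (4 * t))
      fun n => (hζ (φ n)).2.le
  have hlim : Tendsto (potentialMap μ t ∘ (ζ ∘ φ)) atTop (𝓝 (potentialMap μ t a)) :=
    (continuousWithinAt_potentialMap hμ t hae ha0).tendsto.comp
      (tendsto_nhdsWithin_iff.2 ⟨ha, Eventually.of_forall fun n => (hζ (φ n)).1.le⟩)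
  have hlim' : Tendsto (potentialMap μ t ∘ (ζ ∘ φ)) atTop (𝓝 (logPotential μ z)) := by
    refine ((hasDerivAt_logPotential hμ hz).continuousAt.tendsto.comp hvφ).congr fun n => ?_
    exact (hζv _).symm
  have heq := tendsto_nhds_unique hlim hlim'
  refine ⟨a, ha0.lt_of_ne fun h => ?_, hk, heq⟩
  have h1 := im_logPotential_mem_Ioo hμ hz
  rw [← heq] at h1
  rcases im_potentialMap_of_im_eq_zero hμ t haR h.symm with h2 | h2
  · exact h1.1.ne' h2
  · exact h1.2.ne h2

lemma isPreconnected_im_pos_norm_gt {C : ℝ} (hC : 0 < C) :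
    IsPreconnected {z : ℂ | 0 < z.im ∧ C < ‖z‖} := by
  have hconv : Convex ℝ ({z : ℂ | Real.log C < z.re} ∩
      ({z : ℂ | 0 < z.im} ∩ {z : ℂ | z.im < Real.pi})) :=
    (convex_halfSpace_re_gt _).inter
      ((convex_halfSpace_im_gt _).inter (convex_halfSpace_im_lt _))
  have himg : {z : ℂ | 0 < z.im ∧ C < ‖z‖} = Complex.exp '' ({z : ℂ | Real.log C < z.re} ∩
      ({z : ℂ | 0 < z.im} ∩ {z : ℂ | z.im < Real.pi})) := by
    ext z
    constructor
    · rintro ⟨h1, h2⟩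
      have hz : z ≠ 0 := by rintro rfl; simp at h1
      refine ⟨Complex.log z, ⟨?_, ?_, ?_⟩, Complex.exp_log hz⟩
      · simp only [mem_ofPred_eq, Complex.log_re]
        exact Real.log_lt_log hC h2
      · simp only [mem_ofPred_eq, Complex.log_im]
        exact lt_of_le_of_ne (Complex.arg_nonneg_iff.2 h1.le) fun h =>
          h1.ne' (Complex.arg_eq_zero_iff.1 h.symm).2
      · simp only [mem_ofPred_eq, Complex.log_im]
        exact lt_of_le_of_ne (Complex.arg_le_pi _) fun h => h1.ne' (Complex.arg_eq_pi_iff.1 h).2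
    · rintro ⟨x, ⟨h1, h2, h3⟩, rfl⟩
      simp only [mem_ofPred_eq] at h1 h2 h3
      refine ⟨?_, ?_⟩
      · rw [Complex.exp_im]
        exact mul_pos (Real.exp_pos _) (Real.sin_pos_of_pos_of_lt_pi h2 h3)
      · rw [Complex.norm_exp]
        exact (Real.log_lt_iff_lt_exp hC).1 h1
  rw [himg]
  exact hconv.isPreconnected.image _ Complex.continuous_exp.continuousOn

lemma IsBurgersSolution.isBounded_loewnerHull (hM : IsBurgersSolution μ M)
    (hμ : ∀ᵐ u ∂μ, |u| ≤ R) (hR : 0 ≤ R) {t : ℝ} (ht : 0 ≤ t) :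
    Bornology.IsBounded (loewnerHull M t) := by
  -- `C < ‖z‖` forces `R + 2 * t + 1 ≤ ‖ζ‖` for the matching `ζ`, so `ζ` is in `charDomain μ t`.
  set C := 5 * R + 4 * t + 2 with hC
  have hCpos : 0 < C := by positivity
  -- The domain is relatively clopen in the connected set `{0 < im, C < ‖z‖}`.
  have hsub : {z : ℂ | 0 < z.im ∧ C < ‖z‖} ⊆ loewnerDomain M t := by
    refine (isPreconnected_im_pos_norm_gt hCpos).subset_of_closure_inter_subset
      (hM.isOpen_loewnerDomain hμ ht) ?_ ?_
    · -- The point of the domain which matches `I * y` has modulus larger than `C`.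
      set y : ℝ := 2 * t + 1 + (2 * (C + R) + R + 1) with hy
      have hypos : 0 < y := by positivity
      have him : (Complex.I * (y : ℂ)).im = y := by simp
      have hnorm : ‖Complex.I * (y : ℂ)‖ = y := by simp [hypos.le]
      have hmem : Complex.I * (y : ℂ) ∈ charDomain μ t :=
        mem_charDomain_of_im hμ ht (by rw [him, hy]; linarith)
      obtain ⟨z, w, hz, hw, -, he⟩ := hM.exists_trajectory_of_mem_charDomain hμ ht hmem
      have h1 := (norm_le_of_re_eq hμ hR ht (mem_exteriorRegion_of_im_pos hz)
        (mem_exteriorRegion_of_im_pos hmem.1) hmem.2.le (congrArg Complex.re he.symm)).2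
      rw [hnorm] at h1
      exact ⟨z, ⟨hz, by linarith⟩, hz, w, hw⟩
    · rintro z ⟨hcl, hz, hzC⟩
      obtain ⟨ζ, hζ, hk, he⟩ := hM.exists_of_mem_closure hμ hR ht hz hcl
        (Or.inl (by linarith))
      have h1 := (norm_le_of_re_eq hμ hR ht (mem_exteriorRegion_of_im_pos hz)
        (mem_exteriorRegion_of_im_pos hζ) hk (congrArg Complex.re he.symm)).1
      exact (hM.mem_loewnerDomain_iff hμ ht).2
        ⟨hz, ζ, ⟨hζ, lt_one_of_norm_ge hμ ht (by linarith)⟩, he⟩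
  refine Metric.isBounded_closedBall.subset (s := loewnerHull M t)
    (t := Metric.closedBall (0 : ℂ) C) fun z hz => ?_
  rw [mem_closedBall_zero_iff]
  by_contra h
  exact hz.2 (hsub ⟨hz.1, not_le.1 h⟩)

/-! ### The boundary of the hull -/

/-- The boundary of the hull corresponds to `charCurve μ t` under the two potentials. -/
lemma IsBurgersSolution.frontier_loewnerHull (hM : IsBurgersSolution μ M)
    (hμ : ∀ᵐ u ∂μ, |u| ≤ R) (hR : 0 ≤ R) {t : ℝ} (ht : 9 * R ^ 2 < t) :
    frontier (loewnerHull M t) ∩ {z : ℂ | 0 < z.im} =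
      {z : ℂ | 0 < z.im ∧ ∃ ζ ∈ charCurve μ t, potentialMap μ t ζ = logPotential μ z} := by
  have ht0 : 0 < t := lt_of_le_of_lt (by positivity) ht
  have hopen := hM.isOpen_loewnerDomain hμ ht0.le
  have hfr : ∀ z : ℂ, 0 < z.im → (z ∈ frontier (loewnerHull M t) ↔
      z ∈ closure (loewnerDomain M t) ∧ z ∉ loewnerDomain M t) := by
    intro z hz
    rw [frontier_eq_closure_inter_closure]
    have h1 : z ∈ closure (loewnerHull M t)ᶜ ↔ z ∈ closure (loewnerDomain M t) := by
      refine ⟨fun h => ?_, fun h => closure_mono (fun y hy hy' => hy'.2 hy) h⟩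
      rw [mem_closure_iff_nhds] at h ⊢
      intro V hV
      obtain ⟨y, hyV, hy⟩ := h _ (Filter.inter_mem hV (isOpen_im_pos.mem_nhds hz))
      refine ⟨y, hyV.1, ?_⟩
      by_contra hyD
      exact hy ⟨hyV.2, hyD⟩
    have h2 : z ∈ closure (loewnerHull M t) ↔ z ∉ loewnerDomain M t := by
      refine ⟨fun h hD => ?_, fun h => subset_closure ⟨hz, h⟩⟩
      obtain ⟨y, hyV, hy⟩ := mem_closure_iff_nhds.1 h _ (hopen.mem_nhds hD)
      exact hy.2 hyV
    rw [mem_inter_iff, h1, h2, and_comm]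
  ext z
  constructor
  · rintro ⟨hf, hz⟩
    obtain ⟨hcl, hD⟩ := (hfr z hz).1 hf
    obtain ⟨ζ, hζ, hk, he⟩ := hM.exists_of_mem_closure hμ hR ht0.le hz hcl (Or.inr ht)
    refine ⟨hz, ζ, ⟨hζ, hk.eq_or_lt.resolve_right fun hlt => hD ?_⟩, he⟩
    exact (hM.mem_loewnerDomain_iff hμ ht0.le).2 ⟨hz, ζ, ⟨hζ, hlt⟩, he⟩
  · rintro ⟨hz, ζ, hζ, he⟩
    refine ⟨(hfr z hz).2 ⟨?_, fun hD => ?_⟩, hz⟩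
    -- The curve is approached from `charDomain μ t`, whose points match points of the domain.
    all_goals
      have hne := charCurve_neBot hμ ht0 hζ
      have hlim : Tendsto (potentialMap μ t) (𝓝[charDomain μ t] ζ) (𝓝 (potentialMap μ t ζ)) :=
        (hasDerivAt_potentialMap hμ t hζ.1).continuousAt.tendsto.mono_left nhdsWithin_le_nhds
    · rw [mem_closure_iff_nhds]
      intro V hV
      rw [he, ← logPotential_map_nhds hμ hz] at hlim
      have h1 : ∀ᶠ ξ in 𝓝[charDomain μ t] ζ,
          potentialMap μ t ξ ∈ logPotential μ '' (V ∩ {z : ℂ | 0 < z.im}) :=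
        hlim (image_mem_map (Filter.inter_mem hV (isOpen_im_pos.mem_nhds hz)))
      obtain ⟨ξ, ⟨v, hv, hvξ⟩, hξ⟩ := (h1.and self_mem_nhdsWithin).exists
      exact ⟨v, hv.1, (hM.mem_loewnerDomain_iff hμ ht0.le).2 ⟨hv.2, ξ, hξ, hvξ.symm⟩⟩
    · obtain ⟨-, ζ', hζ', he'⟩ := (hM.mem_loewnerDomain_iff hμ ht0.le).1 hD
      have hneq : ζ' ≠ ζ := fun h => (h ▸ hζ').2.ne hζ.2
      obtain ⟨V', V, hV'o, hVo, hζV', hζV, hdisj⟩ := t2_separation hneq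
      rw [he, ← he', ← potentialMap_map_nhds hμ ht0.le hζ'] at hlim
      have h1 : ∀ᶠ ξ in 𝓝[charDomain μ t] ζ,
          potentialMap μ t ξ ∈ potentialMap μ t '' (V' ∩ charDomain μ t) :=
        hlim (image_mem_map (Filter.inter_mem (hV'o.mem_nhds hζV')
          ((isOpen_charDomain hμ t).mem_nhds hζ')))
      obtain ⟨ξ, ⟨⟨v, hv, hvξ⟩, hξ⟩, hξV⟩ := ((h1.and self_mem_nhdsWithin).and
        (nhdsWithin_le_nhds (hVo.mem_nhds hζV))).exists
      have h2 := hM.potentialMap_injOn hμ ht0.le hv.2 hξ hvξ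
      exact disjoint_left.1 hdisj hv.1 (h2 ▸ hξV)

lemma charCurve_injOn (hμ : ∀ᵐ u ∂μ, |u| ≤ R) {t : ℝ} (ht : 0 ≤ t) :
    InjOn (charMap μ t) (charCurve μ t) :=
  fun _ ha _ hb h => charMap_injOn hμ ht ⟨ha.1, ha.2.le⟩ ⟨hb.1, hb.2.le⟩ h

lemma exists_hitFoot_eq (hμ : ∀ᵐ u ∂μ, |u| ≤ R) {t : ℝ} (ht : 0 ≤ t) {ζ : ℂ}
    (hζ : ζ ∈ charCurve μ t) : ∃ x ∈ hitSet μ t, hitFoot μ t x = ζ := by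
  have him : (charMap μ t ζ).im = 0 := by
    rw [im_charMap hμ t (mem_exteriorRegion_of_im_pos (R := R) hζ.1), hζ.2]; simp
  have hx : (((charMap μ t ζ).re : ℝ) : ℂ) = charMap μ t ζ :=
    Complex.ext (by simp) (by simp [him])
  have hmem : (charMap μ t ζ).re ∈ hitSet μ t := by
    simp only [hitSet, mem_ofPred_eq, hx]
    exact mem_image_of_mem _ hζ
  refine ⟨_, hmem, charCurve_injOn hμ ht (hitFoot_mem hmem) hζ ?_⟩
  rw [charMap_hitFoot hmem, hx]

/-- `hitFoot` is locally the restriction to the real line of a holomorphic inverse of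
`charMap μ t`, because `charMap μ t` is real at a point of the upper half-plane only
on `charCurve μ t`. -/
lemma hitFoot_local (hμ : ∀ᵐ u ∂μ, |u| ≤ R) {t : ℝ} (ht : 0 ≤ t) {x : ℝ} (hx : x ∈ hitSet μ t) :
    hitSet μ t ∈ 𝓝 x ∧ AnalyticAt ℝ (hitFoot μ t) x ∧
      HasDerivAt (hitFoot μ t) (charMapDeriv μ t (hitFoot μ t x))⁻¹ x := by
  have hζ := hitFoot_mem hx
  have hζx := charMap_hitFoot hx
  set ζ := hitFoot μ t x
  obtain ⟨hstrict, han⟩ :=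
    hasStrictDerivAt_of_im_pos (fun z hz => hasDerivAt_charMap hμ t hz) hζ.1
  have hne := charMapDeriv_ne_zero hμ ht hζ.1 hζ.2.le
  have hderiv : deriv (charMap μ t) ζ = charMapDeriv μ t ζ := hstrict.hasDerivAt.deriv
  have hne' : deriv (charMap μ t) ζ ≠ 0 := by rwa [hderiv]
  set L := han.hasStrictDerivAt.localInverse _ _ _ hne' with hL
  have hLan : AnalyticAt ℂ L (x : ℂ) := by
    have := han.analyticAt_localInverse hne'
    rwa [hζx] at this
  have hLζ : L (x : ℂ) = ζ := by
    rw [← hζx]; exact HasStrictFDerivAt.localInverse_apply_image ..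
  have hLd : HasDerivAt L (charMapDeriv μ t ζ)⁻¹ (x : ℂ) := by
    have := (han.hasStrictDerivAt.to_localInverse hne').hasDerivAt
    rw [hζx] at this
    exact this.congr_deriv (by rw [hderiv])
  have hr : ∀ᶠ y in 𝓝 (x : ℂ), charMap μ t (L y) = y := by
    have := han.hasStrictDerivAt.eventually_right_inverse hne'
    rwa [hζx] at this
  have hLim : ∀ᶠ y in 𝓝 (x : ℂ), 0 < (L y).im := by
    refine hLan.continuousAt (isOpen_im_pos.mem_nhds ?_)
    rw [hLζ]; exact hζ.1
  have hof : Tendsto (fun y : ℝ => (y : ℂ)) (𝓝 x) (𝓝 (x : ℂ)) :=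
    Complex.continuous_ofReal.tendsto x
  have hev : ∀ᶠ y in 𝓝 x, y ∈ hitSet μ t ∧ hitFoot μ t y = L (y : ℂ) := by
    filter_upwards [hof.eventually hr, hof.eventually hLim] with y hy hy0
    have h1 : L (y : ℂ) ∈ charCurve μ t := by
      refine ⟨hy0, ?_⟩
      have h2 := im_charMap hμ t (mem_exteriorRegion_of_im_pos (R := R) hy0)
      rw [hy, Complex.ofReal_im] at h2
      have := (mul_eq_zero.1 h2.symm).resolve_left hy0.ne'
      linarith
    have h2 : y ∈ hitSet μ t := ⟨_, h1, hy⟩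
    refine ⟨h2, charCurve_injOn hμ ht (hitFoot_mem h2) h1 ?_⟩
    rw [charMap_hitFoot h2, hy]
  have heq : (fun y : ℝ => L (y : ℂ)) =ᶠ[𝓝 x] hitFoot μ t := hev.mono fun y hy => hy.2.symm
  refine ⟨hev.mono fun y hy => hy.1, ?_, ?_⟩
  · refine AnalyticAt.congr ?_ heq
    exact (hLan.restrictScalars (𝕜 := ℝ)).comp_of_eq (Complex.ofRealCLM.analyticAt x) rfl
  · exact hLd.comp_ofReal.congr_of_eventuallyEq heq.symm

/-- On the real line near a hit point, the derivative of `potentialMap μ t ∘ hitFoot μ t` is the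
Cauchy transform at the foot: the factors `charMapDeriv` cancel. -/
lemma hasDerivAt_potentialMap_hitFoot (hμ : ∀ᵐ u ∂μ, |u| ≤ R) {t : ℝ} (ht : 0 ≤ t) {x : ℝ}
    (hx : x ∈ hitSet μ t) :
    HasDerivAt (fun x => potentialMap μ t (hitFoot μ t x))
      (cauchyTransform μ (hitFoot μ t x)) x := by
  have hζ := hitFoot_mem hx
  have hne := charMapDeriv_ne_zero hμ ht hζ.1 hζ.2.le
  refine ((hasDerivAt_potentialMap hμ t hζ.1).comp x (hitFoot_local hμ ht hx).2.2).congr_deriv ?_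
  field_simp

lemma hasDerivAt_im_potentialMap_hitFoot (hμ : ∀ᵐ u ∂μ, |u| ≤ R) {t : ℝ} (ht : 0 ≤ t) {x : ℝ}
    (hx : x ∈ hitSet μ t) :
    HasDerivAt (fun x => (potentialMap μ t (hitFoot μ t x)).im)
      (cauchyTransform μ (hitFoot μ t x)).im x :=
  Complex.imCLM.hasFDerivAt.comp_hasDerivAt x (hasDerivAt_potentialMap_hitFoot hμ ht hx)

/-- On `charCurve μ t` the imaginary part of `potentialMap μ t` lies in `[0, 2 π]` by continuity. It
is strictly monotone along the curve, so it does not attain the extreme values. -/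
lemma IsBurgersSolution.im_potentialMap_mem_Ioo (hM : IsBurgersSolution μ M)
    (hμ : ∀ᵐ u ∂μ, |u| ≤ R) {t : ℝ} (ht : 0 < t) {ζ : ℂ} (hζ : ζ ∈ charCurve μ t) :
    (potentialMap μ t ζ).im ∈ Ioo 0 (2 * Real.pi) := by
  have hIcc : ∀ ξ ∈ charCurve μ t, (potentialMap μ t ξ).im ∈ Icc 0 (2 * Real.pi) := by
    intro ξ hξ
    have hne := charCurve_neBot hμ ht hξ
    have hlim : Tendsto (fun y => (potentialMap μ t y).im) (𝓝[charDomain μ t] ξ)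
        (𝓝 (potentialMap μ t ξ).im) :=
      (Complex.continuous_im.continuousAt.comp
        (hasDerivAt_potentialMap hμ t hξ.1).continuousAt).tendsto.mono_left nhdsWithin_le_nhds
    refine isClosed_Icc.mem_of_tendsto hlim ?_
    filter_upwards [self_mem_nhdsWithin] with y hy
    obtain ⟨z, -, hz, -, -, he⟩ := hM.exists_trajectory_of_mem_charDomain hμ ht.le hy
    rw [he]
    exact Ioo_subset_Icc_self (im_logPotential_mem_Ioo hμ hz)
  obtain ⟨x, hx, rfl⟩ := exists_hitFoot_eq hμ ht.le hζ
  have hd := hasDerivAt_im_potentialMap_hitFoot hμ ht.le hx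
  have hneg := im_cauchyTransform_neg hμ hζ.1
  have hnear := (hitFoot_local hμ ht.le hx).1
  have hb := hIcc _ hζ
  refine ⟨hb.1.lt_of_ne fun h => ?_, hb.2.lt_of_ne fun h => ?_⟩
  · have hmin : IsLocalMin (fun x => (potentialMap μ t (hitFoot μ t x)).im) x := by
      filter_upwards [hnear] with y hy
      rw [← h]
      exact (hIcc _ (hitFoot_mem hy)).1
    exact hneg.ne (hmin.hasDerivAt_eq_zero hd)
  · have hmax : IsLocalMax (fun x => (potentialMap μ t (hitFoot μ t x)).im) x := by
      filter_upwards [hnear] with y hy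
      rw [h]
      exact (hIcc _ (hitFoot_mem hy)).2
    exact hneg.ne (hmax.hasDerivAt_eq_zero hd)

/-- Every point of `charCurve μ t` corresponds to a point of the upper half-plane. -/
lemma IsBurgersSolution.exists_logPotential_eq (hM : IsBurgersSolution μ M)
    (hμ : ∀ᵐ u ∂μ, |u| ≤ R) (hR : 0 ≤ R) {t : ℝ} (ht : 9 * R ^ 2 < t) {ζ : ℂ}
    (hζ : ζ ∈ charCurve μ t) : ∃ z : ℂ, 0 < z.im ∧ logPotential μ z = potentialMap μ t ζ := by
  have ht0 : 0 < t := lt_of_le_of_lt (by positivity) ht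
  have hne := charCurve_neBot hμ ht0 hζ
  obtain ⟨ξ, hξ, hξζ⟩ := mem_closure_iff_seq_limit.1 (mem_closure_iff_nhdsWithin_neBot.2 hne)
  choose v w hv hw hvw he using
    fun n => hM.exists_trajectory_of_mem_charDomain hμ ht0.le (hξ n)
  have hcomp := fun n => norm_le_of_re_eq hμ hR ht0.le (mem_exteriorRegion_of_im_pos (hv n))
    (mem_exteriorRegion_of_im_pos (hξ n).1) (hξ n).2.le (congrArg Complex.re (he n).symm)
  obtain ⟨B, hB⟩ := (Metric.isBounded_range_of_tendsto ξ hξζ).exists_norm_le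
  have hbd : ∀ n, v n ∈ Metric.closedBall (0 : ℂ) (2 * (B + R) + R) := by
    intro n
    rw [mem_closedBall_zero_iff]
    have := hB _ (mem_range_self n)
    linarith [(hcomp n).1]
  obtain ⟨z, -, φ, hφ, hz⟩ := tendsto_subseq_of_bounded Metric.isBounded_closedBall hbd
  have hξφ : Tendsto (ξ ∘ φ) atTop (𝓝 ζ) := hξζ.comp hφ.tendsto_atTop
  have hζe := mem_exteriorRegion_of_im_pos (R := R) hζ.1
  have hzR : R < ‖z‖ := by
    have h1 : ‖ζ‖ ≤ 2 * (‖z‖ + R) + R :=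
      le_of_tendsto_of_tendsto' ((continuous_norm.tendsto ζ).comp hξφ)
        (((((continuous_norm.tendsto z).comp hz).add_const R).const_mul 2).add_const R)
        fun n => (hcomp (φ n)).2
    have h2 := five_mul_lt_norm hR ht (four_mul_le_sq hμ hR ht0.le hζe hζ.2.le)
    linarith
  have hz0 : 0 ≤ z.im := ge_of_tendsto' ((Complex.continuous_im.tendsto z).comp hz)
    fun n => (hv (φ n)).le
  have hlim : Tendsto (logPotential μ ∘ (v ∘ φ)) atTop (𝓝 (logPotential μ z)) :=
    (continuousWithinAt_logPotential hμ (Or.inr hzR) hz0).tendsto.comp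
      (tendsto_nhdsWithin_iff.2 ⟨hz, Eventually.of_forall fun n => (hv (φ n)).le⟩)
  have hlim' : Tendsto (logPotential μ ∘ (v ∘ φ)) atTop (𝓝 (potentialMap μ t ζ)) := by
    refine ((hasDerivAt_potentialMap hμ t hζ.1).continuousAt.tendsto.comp hξφ).congr fun n => ?_
    exact he _
  have heq := tendsto_nhds_unique hlim hlim'
  refine ⟨z, hz0.lt_of_ne fun h => ?_, heq⟩
  have h1 := hM.im_potentialMap_mem_Ioo hμ ht0 hζ
  rw [← heq] at h1
  rcases im_logPotential_of_im_eq_zero hμ hzR h.symm with h2 | h2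
  · exact h1.1.ne' h2
  · exact h1.2.ne h2

lemma charCurve_nonempty (hμ : ∀ᵐ u ∂μ, |u| ≤ R) {t : ℝ} (ht : 9 * R ^ 2 < t) :
    (charCurve μ t).Nonempty := by
  have ht0 : 0 < t := lt_of_le_of_lt (by positivity) ht
  have him : ∀ y : ℝ, (Complex.I * (y : ℂ)).im = y := by simp
  have hext : ∀ y ∈ Ioi (0 : ℝ), Complex.I * (y : ℂ) ∈ exteriorRegion R := fun y hy =>
    Or.inl (by rw [him]; exact hy)
  have hcont : ContinuousOn (fun y : ℝ => 4 * t * invSqDist μ (Complex.I * y)) (Ioi 0) := by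
    intro y hy
    refine ContinuousAt.continuousWithinAt (continuousAt_const.mul ?_)
    exact (continuousAt_invSqDist hμ (hext y hy)).comp (f := fun y : ℝ => Complex.I * (y : ℂ))
      (by fun_prop)
  have hs : 0 < Real.sqrt t := Real.sqrt_pos.2 ht0
  have hlow : 4 * t * invSqDist μ (Complex.I * ((2 * t + 1 : ℝ) : ℂ)) ≤ 1 :=
    (mem_charDomain_of_im hμ ht0.le (by rw [him])).2.le
  have hhigh : 1 ≤ 4 * t * invSqDist μ (Complex.I * (Real.sqrt t : ℂ)) := by
    have h1 := le_invSqDist hμ (hext _ hs) (C := 2 * Real.sqrt t) (fun u hu => by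
      have h2 := norm_sub_ofReal_le (Complex.I * (Real.sqrt t : ℂ)) hu
      rw [norm_mul, Complex.norm_I, one_mul, Complex.norm_real, Real.norm_of_nonneg hs.le] at h2
      have h3 : R ≤ Real.sqrt t := Real.le_sqrt_of_sq_le (by nlinarith)
      linarith)
    rw [mul_pow, Real.sq_sqrt ht0.le] at h1
    calc (1 : ℝ) = 4 * t * (1 / (2 ^ 2 * t)) := by field_simp; norm_num
      _ ≤ _ := by gcongr
  obtain ⟨y, hy, hy1⟩ := isPreconnected_Ioi.intermediate_value
    (show 2 * t + 1 ∈ Ioi (0 : ℝ) by simp only [mem_Ioi]; positivity)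
    (show Real.sqrt t ∈ Ioi (0 : ℝ) from hs) hcont ⟨hlow, hhigh⟩
  exact ⟨Complex.I * y, by rw [him]; exact hy, hy1⟩

/-- The set of hit points is an interval: it is open and bounded, and a boundary point of it comes
from a real zero of `1 - 4 t k` outside `[-R, R]`, where `k = invSqDist μ` is strictly monotone on
either side. -/
lemma exists_hitSet_eq_Ioo (hμ : ∀ᵐ u ∂μ, |u| ≤ R) (hR : 0 ≤ R) {t : ℝ} (ht : 9 * R ^ 2 < t) :
    ∃ a b, a < b ∧ hitSet μ t = Ioo a b := by
  have ht0 : 0 < t := lt_of_le_of_lt (by positivity) ht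
  have hopen : IsOpen (hitSet μ t) :=
    isOpen_iff_mem_nhds.2 fun x hx => (hitFoot_local hμ ht0.le hx).1
  have hnorm : ∀ ζ ∈ charCurve μ t, ‖ζ‖ ≤ R + 2 * t + 1 := by
    intro ζ hζ
    by_contra h
    exact (lt_one_of_norm_ge hμ ht0.le (not_le.1 h).le).ne hζ.2
  have hbound : ∀ x ∈ hitSet μ t, |x| ≤ R + 2 * t + 1 + (4 * t + 1) := by
    rintro x ⟨ζ, hζ, hx⟩
    rw [← Real.norm_eq_abs, ← Complex.norm_real, ← hx]
    exact (norm_add_le _ _).trans (add_le_add (hnorm ζ hζ) (norm_two_mul_cauchyTransform_le hμ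
      ht0.le (mem_exteriorRegion_of_im_pos hζ.1) hζ.2.le))
  have hmem : ∀ {r : ℝ}, R < |r| → (r : ℂ) ∈ exteriorRegion R := fun {r} hr =>
    Or.inr (by rwa [Complex.norm_real])
  have hdist : ∀ r u : ℝ, ‖(r : ℂ) - (u : ℂ)‖ = |r - u| := fun r u => by
    rw [← Complex.ofReal_sub, Complex.norm_real, Real.norm_eq_abs]
  have hneq : ∀ {r s : ℝ}, R < |r| → R < |s| → (∀ u : ℝ, |u| ≤ R → |r - u| < |s - u|) →
      4 * t * invSqDist μ r = 1 → 4 * t * invSqDist μ s ≠ 1 := by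
    intro r s hr hs h h1 h2
    have h3 := invSqDist_lt hμ (hmem hr) (hmem hs) fun u hu => by
      rw [hdist, hdist]; exact h u hu
    have := mul_lt_mul_of_pos_left h3 (show 0 < 4 * t by positivity)
    linarith
  have hright : ∀ {r s : ℝ}, R < r → r < s → 4 * t * invSqDist μ r = 1 →
      4 * t * invSqDist μ s ≠ 1 := by
    intro r s hr hrs
    refine hneq (lt_abs.2 (Or.inl hr)) (lt_abs.2 (Or.inl (hr.trans hrs))) fun u hu => ?_
    have := (abs_le.1 hu).2
    rw [abs_of_pos (by linarith), abs_of_pos (by linarith)]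
    linarith
  have hleft : ∀ {r s : ℝ}, r < -R → s < r → 4 * t * invSqDist μ r = 1 →
      4 * t * invSqDist μ s ≠ 1 := by
    intro r s hr hrs
    refine hneq (lt_abs.2 (Or.inr (by linarith))) (lt_abs.2 (Or.inr (by linarith)))
      fun u hu => ?_
    have := (abs_le.1 hu).1
    rw [abs_of_neg (by linarith), abs_of_neg (by linarith)]
    linarith
  refine exists_eq_Ioo_of_frontier_subset
    (P := {x | ∃ r : ℝ, R < r ∧ 4 * t * invSqDist μ r = 1 ∧ charMap μ t r = x})
    (Q := {x | ∃ r : ℝ, r < -R ∧ 4 * t * invSqDist μ r = 1 ∧ charMap μ t r = x})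
    hopen ?_ ⟨_, fun x hx => (abs_le.1 (hbound x hx)).2⟩
    ⟨_, fun x hx => (abs_le.1 (hbound x hx)).1⟩ ?_ ?_ ?_
  · obtain ⟨ζ, hζ⟩ := charCurve_nonempty hμ ht
    obtain ⟨x, hx, -⟩ := exists_hitFoot_eq hμ ht0.le hζ
    exact ⟨x, hx⟩
  · intro x hx
    rw [hopen.frontier_eq] at hx
    obtain ⟨v, hv, hvx⟩ := mem_closure_iff_seq_limit.1 hx.1
    choose ζ hζ hζv using hv
    obtain ⟨a, -, φ, hφ, ha⟩ := tendsto_subseq_of_bounded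
      (Metric.isBounded_closedBall (x := (0 : ℂ)) (r := R + 2 * t + 1)) (x := ζ)
      (fun n => by rw [mem_closedBall_zero_iff]; exact hnorm _ (hζ n))
    have ha0 : 0 ≤ a.im := ge_of_tendsto' ((Complex.continuous_im.tendsto a).comp ha)
      fun n => (hζ (φ n)).1.le
    have haR : R < ‖a‖ := by
      have h1 : 4 * t ≤ (‖a‖ + R) ^ 2 :=
        ge_of_tendsto' ((((continuous_norm.tendsto a).comp ha).add_const R).pow 2) fun n =>
          four_mul_le_sq hμ hR ht0.le (mem_exteriorRegion_of_im_pos (hζ (φ n)).1) (hζ (φ n)).2.le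
      linarith [five_mul_lt_norm hR ht h1]
    have hae : a ∈ exteriorRegion R := Or.inr haR
    have hk : 4 * t * invSqDist μ a = 1 := by
      refine tendsto_nhds_unique
        (((continuousAt_invSqDist hμ hae).tendsto.comp ha).const_mul (4 * t)) ?_
      refine tendsto_const_nhds.congr fun n => ?_
      exact (hζ (φ n)).2.symm
    have hax : charMap μ t a = x := by
      refine tendsto_nhds_unique ((continuousAt_charMap hμ t hae).tendsto.comp ha) ?_
      have : Tendsto (fun n => ((v (φ n) : ℝ) : ℂ)) atTop (𝓝 (x : ℂ)) :=
        (Complex.continuous_ofReal.tendsto x).comp (hvx.comp hφ.tendsto_atTop)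
      refine this.congr fun n => ?_
      exact (hζv _).symm
    have ha1 : a.im = 0 := by
      by_contra hne
      exact hx.2 ⟨a, ⟨ha0.lt_of_ne (Ne.symm hne), hk⟩, hax⟩
    have har : a = (a.re : ℂ) := Complex.ext rfl (by simpa using ha1)
    rw [har, Complex.norm_real, Real.norm_eq_abs] at haR
    rw [har] at hk hax
    rcases lt_abs.1 haR with h | h
    · exact Or.inl ⟨a.re, h, hk, hax⟩
    · exact Or.inr ⟨a.re, by linarith, hk, hax⟩
  · rintro x ⟨r, hr, h1, h2⟩ y ⟨s, hs, h3, h4⟩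
    rcases lt_trichotomy r s with h | h | h
    · exact absurd h3 (hright hr h h1)
    · subst h
      exact_mod_cast h2.symm.trans h4
    · exact absurd h1 (hright hs h h3)
  · rintro x ⟨r, hr, h1, h2⟩ y ⟨s, hs, h3, h4⟩
    rcases lt_trichotomy r s with h | h | h
    · exact absurd h1 (hleft hs h h3)
    · subst h
      exact_mod_cast h2.symm.trans h4
    · exact absurd h3 (hleft hr h h1)

/-! ### The analytic parametrization -/

lemma IsBurgersSolution.isAnalyticCurve (hM : IsBurgersSolution μ M)
    (hμ : ∀ᵐ u ∂μ, |u| ≤ R) (hR : 0 ≤ R) {t : ℝ} (ht : 9 * R ^ 2 < t) :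
    IsAnalyticCurve (frontier (loewnerHull M t) ∩ {z : ℂ | 0 < z.im}) := by
  have ht0 : 0 < t := lt_of_le_of_lt (by positivity) ht
  obtain ⟨a, b, hab, hI⟩ := exists_hitSet_eq_Ioo hμ hR ht
  set γ : ℝ → ℂ := fun x => Function.invFunOn (logPotential μ) {z | 0 < z.im}
    (potentialMap μ t (hitFoot μ t x)) with hγ
  have hex : ∀ x ∈ Ioo a b, ∃ z ∈ {z : ℂ | 0 < z.im},
      logPotential μ z = potentialMap μ t (hitFoot μ t x) := by
    intro x hx
    rw [← hI] at hx
    exact hM.exists_logPotential_eq hμ hR ht (hitFoot_mem hx)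
  have hγim : ∀ x ∈ Ioo a b, 0 < (γ x).im := fun x hx => Function.invFunOn_mem (hex x hx)
  have hγF : ∀ x ∈ Ioo a b, logPotential μ (γ x) = potentialMap μ t (hitFoot μ t x) :=
    fun x hx => Function.invFunOn_eq (hex x hx)
  have hnhds : ∀ x ∈ Ioo a b, Ioo a b ∈ 𝓝 x := fun x hx => isOpen_Ioo.mem_nhds hx
  have han : ∀ x ∈ Ioo a b, AnalyticAt ℝ γ x := by
    intro x hx
    have hx' : x ∈ hitSet μ t := hI ▸ hx
    have hFan := (hasStrictDerivAt_of_im_pos (fun z hz => hasDerivAt_logPotential hμ hz)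
      (hγim x hx)).2
    have hFd : deriv (logPotential μ) (γ x) ≠ 0 := by
      rw [(hasDerivAt_logPotential hμ (hγim x hx)).deriv]
      exact cauchyTransform_ne_zero hμ (hγim x hx)
    set L := hFan.hasStrictDerivAt.localInverse _ _ _ hFd with hL
    have hLan : AnalyticAt ℂ L (potentialMap μ t (hitFoot μ t x)) := by
      have := hFan.analyticAt_localInverse hFd
      rwa [hγF x hx] at this
    have hLx : L (potentialMap μ t (hitFoot μ t x)) = γ x := by
      rw [← hγF x hx]; exact HasStrictFDerivAt.localInverse_apply_image ..
    have hr : ∀ᶠ y in 𝓝 (potentialMap μ t (hitFoot μ t x)), logPotential μ (L y) = y := by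
      have := hFan.hasStrictDerivAt.eventually_right_inverse hFd
      rwa [hγF x hx] at this
    have hLim : ∀ᶠ y in 𝓝 (potentialMap μ t (hitFoot μ t x)), 0 < (L y).im := by
      refine hLan.continuousAt (isOpen_im_pos.mem_nhds ?_)
      rw [hLx]; exact hγim x hx
    have hEan : AnalyticAt ℝ (fun x => potentialMap μ t (hitFoot μ t x)) x :=
      ((hasStrictDerivAt_of_im_pos (fun z hz => hasDerivAt_potentialMap hμ t hz)
        (hitFoot_mem hx').1).2.restrictScalars (𝕜 := ℝ)).comp_of_eq
          (hitFoot_local hμ ht0.le hx').2.1 rfl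
    refine AnalyticAt.congr (f := fun x => L (potentialMap μ t (hitFoot μ t x)))
      ((hLan.restrictScalars (𝕜 := ℝ)).comp_of_eq hEan rfl) ?_
    filter_upwards [hnhds x hx, hEan.continuousAt.eventually hr,
      hEan.continuousAt.eventually hLim] with y hy hy1 hy2
    exact logPotential_injOn hμ hy2 (hγim y hy) (hy1.trans (hγF y hy).symm)
  have hcont : ContinuousOn γ (Ioo a b) := fun x hx => (han x hx).continuousAt.continuousWithinAt
  refine ⟨a, b, γ, hab, han, fun x hx h0 => ?_, ?_, ?_⟩
  · have hx' : x ∈ hitSet μ t := hI ▸ hx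
    have h1 := (hasDerivAt_logPotential hμ (hγim x hx)).comp x
      (han x hx).differentiableAt.hasDerivAt
    have h2 := (hasDerivAt_potentialMap_hitFoot hμ ht0.le hx').congr_of_eventuallyEq
      (f₁ := logPotential μ ∘ γ) (by filter_upwards [hnhds x hx] with y hy using hγF y hy)
    have h3 := h1.unique h2
    rw [h0, mul_zero] at h3
    exact cauchyTransform_ne_zero hμ (hitFoot_mem hx').1 h3.symm
  · -- The imaginary part of the potential is a coordinate along the curve.
    have hanti : StrictAntiOn (fun x => (potentialMap μ t (hitFoot μ t x)).im) (Ioo a b) := by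
      refine strictAntiOn_of_deriv_neg (convex_Ioo a b) (fun x hx => ?_) fun x hx => ?_
      · exact (hasDerivAt_im_potentialMap_hitFoot hμ ht0.le
          (hI ▸ hx)).continuousAt.continuousWithinAt
      · rw [interior_Ioo, ← hI] at hx
        rw [(hasDerivAt_im_potentialMap_hitFoot hμ ht0.le hx).deriv]
        exact im_cauchyTransform_neg hμ (hitFoot_mem hx).1
    have hFcont : Continuous fun z : {z : ℂ // 0 < z.im} => -(logPotential μ z).im := by
      refine continuous_iff_continuousAt.2 fun z => ?_
      exact (Complex.continuous_im.continuousAt.comp ((hasDerivAt_logPotential hμ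
        z.2).continuousAt.comp continuous_subtype_val.continuousAt)).neg
    let γ' : Ioo a b → {z : ℂ // 0 < z.im} := fun s => ⟨γ s, hγim s s.2⟩
    have hγ'c : Continuous γ' := Continuous.subtype_mk hcont.domRestrict _
    have hmono : StrictMono ((fun z : {z : ℂ // 0 < z.im} => -(logPotential μ z).im) ∘ γ') := by
      intro s r hsr
      simp only [Function.comp, γ', hγF s s.2, hγF r r.2]
      exact neg_lt_neg (hanti s.2 r.2 hsr)
    have : PreconnectedSpace (Ioo a b) := isPreconnected_iff_preconnectedSpace.1 isPreconnected_Ioo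
    have : OrdConnected
        (range ((fun z : {z : ℂ // 0 < z.im} => -(logPotential μ z).im) ∘ γ')) :=
      (isPreconnected_range (hFcont.comp hγ'c)).ordConnected
    have hemb := Topology.IsEmbedding.of_comp hγ'c hFcont (hmono.isEmbedding_of_ordConnected this)
    exact Topology.IsEmbedding.subtypeVal.comp hemb
  · rw [hM.frontier_loewnerHull hμ hR ht]
    ext z
    constructor
    · rintro ⟨x, hx, rfl⟩
      exact ⟨hγim x hx, _, hitFoot_mem (hI ▸ hx), (hγF x hx).symm⟩
    · rintro ⟨hz, ζ, hζ, he⟩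
      obtain ⟨x, hx, rfl⟩ := exists_hitFoot_eq hμ ht0.le hζ
      rw [hI] at hx
      exact ⟨x, hx, logPotential_injOn hμ (hγim x hx) hz ((hγF x hx).trans he)⟩

end Hull
end

theorem theorem2 (μ : Measure ℝ) [IsProbabilityMeasure μ]
    (R : ℝ) (hμ : μ (Icc (-R) R)ᶜ = 0)
    (M : ℝ → ℂ → ℂ) (hM : IsBurgersSolution μ M) :
    (∀ t : ℝ, 0 ≤ t → Bornology.IsBounded (loewnerHull M t)) ∧
    ∃ T : ℝ, 0 < T ∧ ∀ t : ℝ, T < t →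
      IsAnalyticCurve (frontier (loewnerHull M t) ∩ {z : ℂ | 0 < z.im}) := by
  have hae : ∀ᵐ u ∂μ, |u| ≤ R := by
    filter_upwards [measure_eq_zero_iff_ae_notMem.1 hμ] with u hu
    exact abs_le.2 (not_not.1 hu)
  have hR : 0 ≤ R := by
    obtain ⟨u, hu⟩ := hae.exists
    exact (abs_nonneg u).trans hu
  refine ⟨fun t ht => hM.isBounded_loewnerHull hae hR ht, 9 * R ^ 2 + 1, by positivity,
    fun t ht => hM.isAnalyticCurve hae hR (by linarith)⟩
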